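/- A difference ring is a commutative ring $R$ with a ring endomorphism $\sigma_R$; a difference algebra over a difference ring $k$ is a commutative $k$-algebra $A$ with a ring endomorphism $\sigma_A$ such that $k\to A$ commutes with the endomorphisms; a difference profinite space is a profinite space with a continuous self-map, and a difference profinite group is a profinite group with a continuous endomorphism. For a commutative ring $R$ let $S(R)$ be its Pierce spectrum, the profinite space of ultrafilters of the Boolean algebra of idempotents of $R$; it is contravariant in $R$, so an endomorphism of $R$ makes it a difference profinite space. Let $(L,\sigma_L)/(k,\sigma_k)$ be an extension of difference fields such that $L/k$ is a (possibly infinite) Galois extension of fields, and let $f:L\to k$ be the corresponding morphism in the opposite category of difference rings. For a difference profinite space $X$ put $C_L(X)=(\mathrm{Cont}(X,L),\ h\mapsto \sigma_L\circ h\circ\sigma_X)$, with $L$ discrete. Let $\mathrm{Split}_k(f)$ be the opposite of the category of difference $k$-algebras $A$ for which $(L\otimes_kA,\sigma_L\otimes\sigma_A)$ is isomorphic to some $C_L(X)$ as a difference $L$-algebra. Let $[\![A,B]\!]_k$ be the set of sequences $(f_i)_{i\ge 0}$ of $k$-algebra homomorphisms $A\to B$ with $f_i\sigma_A=\sigma_Bf_{i+1}$,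 with the shift and the topology with subbasis the sets $\{f: f_n(a)=b\}$, and let $\mathrm{Aut}[\![L]\!]_k\subseteq[\![L,L]\!]_k$ consist of the sequences of isomorphisms. Let $\mathrm{Hom}_k(A,L)$ be the space of $k$-algebra homomorphisms (without difference structure), with the topology of pointwise convergence, $L$ discrete. 1. A difference $k$-algebra $A$ is in $\mathrm{Split}_k(f)$ if and only if its underlying algebra is split by $L$, i.e. $L\otimes_kA\simeq \mathrm{Cont}(X,L)$ as $L$-algebras for some profinite space $X$; equivalently, every element of $A$ is a root of a separable polynomial over $k$ that splits over $L$. 2. There is a continuous endomorphism $()^\sigma$ of $\mathrm{Gal}(L/k)$ with $g\circ\sigma_L=\sigma_L\circ g^\sigma$, and, for every $A$ in $\mathrm{Split}_k(f)$, a continuous self-map $()^\sigma$ of $\mathrm{Hom}_k(A,L)$ with $h\circ\sigma_A=\sigma_L\circ h^\sigma$ (these maps are unique, since $\sigma_L$ is injective). 3. The categorical Galois groupoid $\mathrm{Gal}[f]=(S(L\otimes_kL)\rightrightarrows S(L))$, whose operations are induced by $((x_1,x_2),(x_2,x_3))\mapsto(x_1,x_3)$, has a single object and is a difference profinite group, and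 there are isomorphisms of difference profinite groups $$\mathrm{Gal}[f]=S(L\otimes_kL)\simeq \mathrm{Aut}[\![L]\!]_k\simeq(\mathrm{Gal}(L/k),()^\sigma).$$ The second sends $(g_i)_i$ to $g_0$; the isomorphism $\mathrm{Gal}(L/k)\to S(L\otimes_kL)$ sends $g$ to the set of idempotents that $a\otimes b\mapsto a\,g(b)$ maps to $1$. 4. There is an equivalence of categories between $\mathrm{Split}_k(f)$ and the category $[\mathrm{Gal}[f],\mathcal P]$ of difference profinite spaces with an action of the difference profinite group $\mathrm{Gal}[f]$. It is realised by $$A\mapsto S(L\otimes_kA)\simeq[\![A,L]\!]_k\simeq(\mathrm{Hom}_k(A,L),()^\sigma),$$ where $\mathrm{Gal}[f]$ acts on $S(L\otimes_kA)$ by the canonical action of the groupoid, induced by $((x_1,x_2),(x_2,a))\mapsto(x_1,a)$. The isomorphisms are isomorphisms of difference profinite spaces, natural in $A$, given by $(f_i)_i\mapsto f_0$ and by sending $h\in\mathrm{Hom}_k(A,L)$ to the set of idempotents that $a\otimes b\mapsto a\,h(b)$ maps to $1$; they identify this action with the actions of $\mathrm{Aut}[\![L]\!]_k$ and of $\mathrm{Gal}(L/k)$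 by composition. A quasi-inverse is $$X\mapsto (f_!\,C_L(X))^{\mathrm{Gal}[f]},$$ where $f_!\,C_L(X)$ is $C_L(X)$ regarded as a difference $k$-algebra, and where $g\in\mathrm{Gal}[f]\simeq\mathrm{Gal}(L/k)$ acts on $h\in\mathrm{Cont}(X,L)$ by $(g\cdot h)(x)=g(h(g^{-1}x))$. -/

import Mathlib

universe u

open CategoryTheory Opposite
open scoped TensorProduct

noncomputable section

namespace DiffGalois

/-! ### Pierce spectrum -/

section Pierce

/-- A point of the Pierce spectrum `S₀(R)`: an ultrafilter of the Boolean algebra `E(R)` of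
idempotents of `R` (meet = product, complement = `1 - e`, bottom = `0`, top = `1`;
`e ≤ e'` iff `e = e' * e`). -/
@[ext]
structure PierceSpec (R : Type u) [CommRing R] : Type u where
  carrier : Set R
  idem : ∀ e ∈ carrier, IsIdempotentElem e
  one_mem : (1 : R) ∈ carrier
  zero_notMem : (0 : R) ∉ carrier
  mul_mem : ∀ e ∈ carrier, ∀ e' ∈ carrier, e * e' ∈ carrier
  upward : ∀ e e' : R, e' * e ∈ carrier → IsIdempotentElem e' → e' ∈ carrier
  mem_or : ∀ e : R, IsIdempotentElem e → e ∈ carrier ∨ 1 - e ∈ carrier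

variable {R : Type u} [CommRing R] {R' : Type u} [CommRing R']

/-- The Stone topology, generated by the sets of ultrafilters containing a given idempotent. -/
instance : TopologicalSpace (PierceSpec R) :=
  TopologicalSpace.generateFrom
    {U | ∃ e : R, IsIdempotentElem e ∧ U = {x : PierceSpec R | e ∈ x.carrier}}

theorem PierceSpec.isOpen_basic {e : R} (he : IsIdempotentElem e) :
    IsOpen {x : PierceSpec R | e ∈ x.carrier} :=
  TopologicalSpace.isOpen_generateFrom_of_mem ⟨e, he, rfl⟩

theorem PierceSpec.one_sub_mem_iff (x : PierceSpec R) {e : R} (he : IsIdempotentElem e) :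
    1 - e ∈ x.carrier ↔ e ∉ x.carrier := by
  constructor
  · intro h h'
    have := x.mul_mem _ h' _ h
    rw [mul_sub, mul_one, he.eq, sub_self] at this
    exact x.zero_notMem this
  · intro h
    exact (x.mem_or e he).resolve_left h

theorem PierceSpec.isClopen_basic {e : R} (he : IsIdempotentElem e) :
    IsClopen {x : PierceSpec R | e ∈ x.carrier} := by
  refine ⟨⟨?_⟩, PierceSpec.isOpen_basic he⟩
  have : {x : PierceSpec R | e ∈ x.carrier}ᶜ = {x : PierceSpec R | 1 - e ∈ x.carrier} := by
    ext x
    simpa using (x.one_sub_mem_iff he).symm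
  rw [this]
  exact PierceSpec.isOpen_basic he.one_sub

instance : TotallySeparatedSpace (PierceSpec R) := by
  refine ⟨fun x _ y _ hxy => ?_⟩
  have : ∃ e : R, IsIdempotentElem e ∧ e ∈ x.carrier ∧ e ∉ y.carrier := by
    by_contra! H
    refine hxy (PierceSpec.ext (Set.Subset.antisymm (fun e he => H e (x.idem e he) he) ?_))
    intro e he
    have hi := y.idem e he
    by_contra hx
    exact ((y.one_sub_mem_iff hi).1
      (H _ hi.one_sub ((x.one_sub_mem_iff hi).2 hx))) he
  obtain ⟨e, he, hx, hy⟩ := this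
  exact ⟨_, _, (PierceSpec.isClopen_basic he).2, (PierceSpec.isClopen_basic he).1.isOpen_compl,
    hx, hy, fun z _ => Classical.em _, disjoint_compl_right⟩

open Classical in
instance : CompactSpace (PierceSpec R) := by
  let ι : PierceSpec R → (R → Bool) := fun x e => decide (e ∈ x.carrier)
  have hmem : ∀ (x : PierceSpec R) e, ι x e = true ↔ e ∈ x.carrier := fun x e => by simp [ι]
  have hcl : ∀ e : R, IsClopen {p : R → Bool | p e = true} := fun e =>
    (isClopen_discrete {true}).preimage (continuous_apply e)
  have himp : ∀ {P Q : (R → Bool) → Prop}, IsClopen {p | P p} → IsClosed {p | Q p} →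
      IsClosed {p | P p → Q p} := by
    intro P Q hP hQ
    have : {p | P p → Q p} = {p | P p}ᶜ ∪ {p | Q p} := by
      ext p; simp [imp_iff_not_or]
    rw [this]
    exact hP.compl.1.union hQ
  have hrange : Set.range ι =
      {p | ∀ e, p e = true → IsIdempotentElem e} ∩ ({p | p 1 = true} ∩ ({p | p 0 = true}ᶜ ∩
      ({p | ∀ e, p e = true → ∀ e', p e' = true → p (e * e') = true} ∩
      ({p | ∀ e e', p (e' * e) = true → IsIdempotentElem e' → p e' = true} ∩
      {p | ∀ e, IsIdempotentElem e → (p e = true ∨ p (1 - e) = true)})))) := by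
    ext p
    constructor
    · rintro ⟨x, rfl⟩
      refine ⟨fun e h => x.idem e ((hmem x e).1 h), (hmem x 1).2 x.one_mem,
        fun h => x.zero_notMem ((hmem x 0).1 h), fun e h e' h' =>
          (hmem x _).2 (x.mul_mem _ ((hmem x _).1 h) _ ((hmem x _).1 h')), fun e e' h h' =>
          (hmem x _).2 (x.upward _ _ ((hmem x _).1 h) h'), fun e h => ?_⟩
      exact (x.mem_or e h).imp (hmem x _).2 (hmem x _).2
    · rintro ⟨h1, h2, h3, h4, h5, h6⟩
      exact ⟨⟨{e | p e = true}, h1, h2, h3, h4, h5, h6⟩, by funext e; simp [ι]⟩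
  have hclosed : IsClosed (Set.range ι) := by
    rw [hrange]
    refine IsClosed.inter ?_ (IsClosed.inter (hcl 1).1 (IsClosed.inter (hcl 0).compl.1
      (IsClosed.inter ?_ (IsClosed.inter ?_ ?_))))
    · simp only [Set.ofPred_forall]
      exact isClosed_iInter fun e => himp (hcl e) isClosed_const
    · simp only [Set.ofPred_forall]
      refine isClosed_iInter fun e => ?_
      have := fun e' => himp (hcl e') (hcl (e * e')).1
      exact himp (hcl e) (by simp only [Set.ofPred_forall]; exact isClosed_iInter this)
    · simp only [Set.ofPred_forall]
      refine isClosed_iInter fun e => isClosed_iInter fun e' => himp (hcl _) ?_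
      by_cases h : IsIdempotentElem e'
      · simpa [h] using (hcl e').1
      · simp [h]
    · simp only [Set.ofPred_forall]
      exact isClosed_iInter fun e => isClosed_iInter fun _ => (hcl e).1.union (hcl _).1
  have hind : Topology.IsInducing ι := by
    refine ⟨le_antisymm ?_ ?_⟩
    · rw [← continuous_iff_le_induced]
      refine continuous_pi fun e => ?_
      by_cases he : IsIdempotentElem e
      · rw [continuous_discrete_rng]
        intro b
        cases b
        · convert (PierceSpec.isClopen_basic he).compl.2 using 1
          ext x; simp [ι]
        · convert (PierceSpec.isClopen_basic he).2 using 1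
          ext x; simp [ι]
      · have : (fun x : PierceSpec R => ι x e) = fun _ => false := by
          funext x
          simpa [ι] using fun h => he (x.idem e h)
        rw [this]
        exact continuous_const
    · refine le_generateFrom ?_
      rintro U ⟨e, he, rfl⟩
      refine ⟨_, (hcl e).2, ?_⟩
      ext x
      exact hmem x e
  exact ⟨hind.isCompact_iff.2 (by rw [Set.image_univ]; exact hclosed.isCompact)⟩

/-- The (contravariant) action of the Pierce spectrum on ring homomorphisms. -/
def PierceSpec.map (φ : R →+* R') (x : PierceSpec R') : PierceSpec R where
  carrier := {e | IsIdempotentElem e ∧ φ e ∈ x.carrier}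
  idem e he := he.1
  one_mem := ⟨IsIdempotentElem.one, by simpa using x.one_mem⟩
  zero_notMem h := x.zero_notMem (by simpa using h.2)
  mul_mem e he e' he' := ⟨he.1.mul he'.1, by simpa using x.mul_mem _ he.2 _ he'.2⟩
  upward e e' h h' := ⟨h', x.upward (φ e) (φ e') (by simpa using h.2) (h'.map φ)⟩
  mem_or e he := (x.mem_or (φ e) (he.map φ)).imp (fun h => ⟨he, h⟩)
    (fun h => ⟨he.one_sub, by simpa using h⟩)

theorem PierceSpec.continuous_map (φ : R →+* R') : Continuous (PierceSpec.map φ) := by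
  refine continuous_generateFrom_iff.2 ?_
  rintro U ⟨e, he, rfl⟩
  convert PierceSpec.isOpen_basic (he.map φ) using 1
  ext x
  exact ⟨fun h => h.2, fun h => ⟨he, h⟩⟩

theorem PierceSpec.map_id (x : PierceSpec R) : PierceSpec.map (RingHom.id R) x = x :=
  PierceSpec.ext (Set.ext fun e => ⟨fun h => h.2, fun h => ⟨x.idem e h, h⟩⟩)

theorem PierceSpec.map_map {R'' : Type u} [CommRing R''] (φ : R →+* R') (ψ : R' →+* R'')
    (x : PierceSpec R'') : PierceSpec.map φ (PierceSpec.map ψ x) = PierceSpec.map (ψ.comp φ) x :=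
  PierceSpec.ext (Set.ext fun e => ⟨fun h => ⟨h.1, h.2.2⟩, fun h => ⟨h.1, h.1.map φ, h.2⟩⟩)

/-- The point of `S₀(R)` determined by a ring homomorphism `φ` from `R` to a field:
the idempotents that `φ` sends to `1`. -/
def PierceSpec.ofHom {F : Type u} [Field F] (φ : R →+* F) : PierceSpec R where
  carrier := {e | IsIdempotentElem e ∧ φ e = 1}
  idem _ he := he.1
  one_mem := ⟨IsIdempotentElem.one, map_one φ⟩
  zero_notMem h := by simpa using h.2
  mul_mem e he e' he' := ⟨he.1.mul he'.1, by rw [map_mul, he.2, he'.2, one_mul]⟩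
  upward _ e' h h' := by
    refine ⟨h', ?_⟩
    rcases (IsIdempotentElem.iff_eq_zero_or_one).1 (h'.map φ) with h0 | h1
    · have := h.2
      rw [map_mul, h0, zero_mul] at this
      exact absurd this zero_ne_one
    · exact h1
  mem_or _ he := by
    rcases (IsIdempotentElem.iff_eq_zero_or_one).1 (he.map φ) with h0 | h1
    · exact Or.inr ⟨he.one_sub, by rw [map_sub, map_one, h0, sub_zero]⟩
    · exact Or.inl ⟨he, h1⟩

end Pierce

/-! ### Difference algebras -/

/-- A difference algebra over the difference ring `(k, σk)`: a commutative `k`-algebra with a ring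
endomorphism `σ` for which the structure map is a morphism of difference rings. -/
structure DiffAlg (k : Type u) [CommRing k] (σk : k →+* k) where
  carrier : Type u
  [commRing : CommRing carrier]
  [algebra : Algebra k carrier]
  σ : carrier →+* carrier
  σ_algebraMap : ∀ c : k, σ (algebraMap k carrier c) = algebraMap k carrier (σk c)

namespace DiffAlg

variable {k : Type u} [CommRing k] {σk : k →+* k}

instance : CoeSort (DiffAlg k σk) (Type u) := ⟨carrier⟩

instance (A : DiffAlg k σk) : CommRing A := A.commRing

instance (A : DiffAlg k σk) : Algebra k A := A.algebra

/-- Morphisms of difference algebras: algebra homomorphisms commuting with the `σ`s. -/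
@[ext]
structure Hom (A B : DiffAlg k σk) where
  toAlgHom : A →ₐ[k] B
  comm : ∀ a : A, toAlgHom (A.σ a) = B.σ (toAlgHom a)

instance : Category (DiffAlg k σk) where
  Hom := Hom
  id A := ⟨AlgHom.id k A, fun _ => rfl⟩
  comp f g := ⟨g.toAlgHom.comp f.toAlgHom, fun a => by simp [f.comm, g.comm]⟩

end DiffAlg

/-! ### Difference profinite spaces and actions of difference groups on them -/

/-- A difference profinite space: a profinite space with a continuous self-map. -/
structure DiffProf where
  carrier : Type u
  [top : TopologicalSpace carrier]
  [compact : CompactSpace carrier]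
  [t2 : T2Space carrier]
  [totDisc : TotallyDisconnectedSpace carrier]
  σ : C(carrier, carrier)

namespace DiffProf

instance : CoeSort DiffProf.{u} (Type u) := ⟨carrier⟩

instance (X : DiffProf.{u}) : TopologicalSpace X := X.top

instance (X : DiffProf.{u}) : CompactSpace X := X.compact

instance (X : DiffProf.{u}) : T2Space X := X.t2

instance (X : DiffProf.{u}) : TotallyDisconnectedSpace X := X.totDisc

@[ext]
structure Hom (X Y : DiffProf.{u}) where
  toMap : C(X, Y)
  comm : ∀ x : X, toMap (X.σ x) = Y.σ (toMap x)

instance : Category DiffProf.{u} where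
  Hom := Hom
  id X := ⟨ContinuousMap.id X, fun _ => rfl⟩
  comp f g := ⟨g.toMap.comp f.toMap, fun x => by simp [f.comm, g.comm]⟩

end DiffProf

/-- A difference profinite space with a (continuous) action of the difference topological group
`(G, σG)`: the action map `G × X → X` is a morphism of difference spaces. -/
structure DiffProfAct (G : Type u) [Group G] [TopologicalSpace G] (σG : G → G) extends
    DiffProf.{u} where
  [act : MulAction G carrier]
  [contSMul : ContinuousSMul G carrier]
  σ_smul : ∀ (g : G) (x : carrier), σ (g • x) = σG g • σ x

namespace DiffProfAct

variable {G : Type u} [Group G] [TopologicalSpace G] {σG : G → G}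

instance (X : DiffProfAct G σG) : MulAction G X.toDiffProf := X.act

instance (X : DiffProfAct G σG) : ContinuousSMul G X.toDiffProf := X.contSMul

/-- Morphisms of actions: equivariant morphisms of difference profinite spaces. -/
@[ext]
structure Hom (X Y : DiffProfAct G σG) where
  toHom : X.toDiffProf ⟶ Y.toDiffProf
  smul : ∀ (g : G) (x : X.toDiffProf), toHom.toMap (g • x) = g • toHom.toMap x

instance : Category (DiffProfAct G σG) where
  Hom := Hom
  id X := ⟨𝟙 X.toDiffProf, fun _ _ => rfl⟩
  comp f g := ⟨f.toHom ≫ g.toHom, fun a x =>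
    (congrArg g.toHom.toMap (f.smul a x)).trans (g.smul a _)⟩

/-- The functor forgetting the action. -/
def forget (G : Type u) [Group G] [TopologicalSpace G] (σG : G → G) :
    DiffProfAct G σG ⥤ DiffProf.{u} where
  obj X := X.toDiffProf
  map f := f.toHom

end DiffProfAct

/-! ### Base change, split algebras -/

section Split

variable {k : Type u} [CommRing k] {σk : k →+* k} (L : DiffAlg k σk)

/-- `σ_L ⊗ σ_A` on `L ⊗_k A`. -/
def tensorσ (A : DiffAlg k σk) : L ⊗[k] A →+* L ⊗[k] A :=
  Algebra.TensorProduct.mapRingHom σk L.σ A.σ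
    (RingHom.ext L.σ_algebraMap) (RingHom.ext A.σ_algebraMap)

/-- The base change `f^* A = L ⊗_k A`, a difference algebra over `L`. -/
def baseChange (A : DiffAlg k σk) : DiffAlg L L.σ where
  carrier := L ⊗[k] A
  σ := tensorσ L A
  σ_algebraMap c := by
    simp [tensorσ, Algebra.TensorProduct.algebraMap_apply]

/-- The operator `h ↦ σ_L ∘ h ∘ σ_X` on `Cont(X, L)`, where `L` is discrete, so that continuous
functions are the locally constant ones. -/
def contσ (X : DiffProf.{u}) : LocallyConstant X L →+* LocallyConstant X L :=
  (LocallyConstant.mapRingHom L.σ).comp (LocallyConstant.comapRingHom X.σ)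

/-- The difference `L`-algebra `C_L(X) = (Cont(X, L), h ↦ σ_L ∘ h ∘ σ_X)`. -/
def contAlg (X : DiffProf.{u}) : DiffAlg L L.σ where
  carrier := LocallyConstant X L
  σ := contσ L X
  σ_algebraMap c := by
    exact LocallyConstant.ext fun x => rfl

/-- A difference `k`-algebra `A` is split by `f : L → k` if `f^* A` is isomorphic to some `C_L(X)`,
as a difference `L`-algebra. -/
def IsSplit : ObjectProperty (DiffAlg k σk) := fun A =>
  ∃ X : DiffProf.{u}, Nonempty (baseChange L A ≅ contAlg L X)

/-- `Split_k(f)` is the opposite of this category. -/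
abbrev SplitAlg := (IsSplit L).FullSubcategory

/-- The `k`-algebra `A` (without difference structure) is split by the `k`-algebra `L`, with
connected `L`: `L ⊗_k A` is isomorphic to `Cont(X, L)` for some profinite space `X`. -/
def IsSplitBy (k L A : Type u) [CommRing k] [CommRing L] [Algebra k L] [CommRing A]
    [Algebra k A] : Prop :=
  ∃ X : Profinite.{u}, Nonempty (L ⊗[k] A ≃ₐ[L] LocallyConstant X L)

/-- The elementary notion: every element of `A` is annihilated by a polynomial over `k` that is,
over `L`, a product of pairwise distinct linear factors (up to a nonzero constant). -/
def IsSplitElem (k L A : Type u) [Field k] [Field L] [Algebra k L] [CommRing A]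
    [Algebra k A] : Prop :=
  ∀ a : A, ∃ p : Polynomial k, Polynomial.aeval a p = 0 ∧ p.Separable ∧
    (p.map (algebraMap k L)).Splits

theorem map_id_tensor_comp {A B C : DiffAlg k σk} (ψ : C →ₐ[k] B) (φ : B →ₐ[k] A)
    (x : PierceSpec (L ⊗[k] A)) :
    PierceSpec.map (Algebra.TensorProduct.map (AlgHom.id k L) (φ.comp ψ)).toRingHom x =
      PierceSpec.map (Algebra.TensorProduct.map (AlgHom.id k L) ψ).toRingHom
        (PierceSpec.map (Algebra.TensorProduct.map (AlgHom.id k L) φ).toRingHom x) := by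
  rw [PierceSpec.map_map, Algebra.TensorProduct.map_id_comp]
  rfl

/-- The functor `A ↦ S(L ⊗_k A)` from (the opposite of) difference `k`-algebras to difference
profinite spaces. -/
def pierce : (DiffAlg k σk)ᵒᵖ ⥤ DiffProf.{u} where
  obj A :=
    { carrier := PierceSpec (L ⊗[k] A.unop)
      σ := ⟨PierceSpec.map (tensorσ L A.unop), PierceSpec.continuous_map _⟩ }
  map {A B} φ :=
    { toMap := ⟨PierceSpec.map
        (Algebra.TensorProduct.map (AlgHom.id k L) φ.unop.toAlgHom).toRingHom,
          PierceSpec.continuous_map _⟩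
      comm := fun x => by
        refine (PierceSpec.map_map _ _ x).trans (Eq.trans ?_ (PierceSpec.map_map _ _ x).symm)
        congr 1
        refine RingHom.ext fun z => ?_
        induction z using TensorProduct.induction_on with
        | zero => simp
        | tmul a b => simp [tensorσ, φ.unop.comm]
        | add a b ha hb => simp only [map_add, ha, hb] }
  map_id A := by
    refine DiffProf.Hom.ext (ContinuousMap.ext fun x => ?_)
    refine Eq.trans ?_ (PierceSpec.map_id x)
    change PierceSpec.map _ x = PierceSpec.map _ x
    congr 1
    refine RingHom.ext fun z => ?_
    exact DFunLike.congr_fun (Algebra.TensorProduct.map_id (R := k) (S := k)) z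
  map_comp φ ψ :=
    DiffProf.Hom.ext (ContinuousMap.ext fun x =>
      map_id_tensor_comp L ψ.unop.toAlgHom φ.unop.toAlgHom x)

end Split

/-! ### The Galois groupoid and its action on `S(L ⊗_k A)`

In the opposite category of rings, write `X` for `L` and `A` also for the object of the algebra `A`.
The canonical groupoid `X × X ⇉ X` over `k` has composition `((x₁, x₂), (x₂, x₃)) ↦ (x₁, x₃)`,
unit `x ↦ (x, x)` and inverse `(x₁, x₂) ↦ (x₂, x₁)`, and it acts on `X × A` over `X` by
`((x₁, x₂), (x₂, a)) ↦ (x₁, a)`.  The composable pairs are `X × X × A`, that is `L ⊗ (L ⊗ A)`. -/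

section Galois

variable {k : Type u} [CommRing k] {σk : k →+* k} (L : DiffAlg k σk) (A : DiffAlg k σk)

/-- The space of morphisms `S(L ⊗_k L)` of the Galois groupoid. -/
abbrev GalSpace : Type u := PierceSpec (L ⊗[k] L)

/-- The difference operator of `S(L ⊗_k L)`. -/
def galσ : GalSpace L → GalSpace L := PierceSpec.map (tensorσ L L)

/-- `S` of the projection `(x₁, x₂, a) ↦ (x₁, x₂)`. -/
def pr₁₂ : PierceSpec (L ⊗[k] (L ⊗[k] A)) → PierceSpec (L ⊗[k] L) :=
  PierceSpec.map (Algebra.TensorProduct.map (AlgHom.id k L)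
    (Algebra.TensorProduct.includeLeft : L →ₐ[k] L ⊗[k] A)).toRingHom

/-- `S` of the projection `(x₁, x₂, a) ↦ (x₂, a)`. -/
def pr₂₃ : PierceSpec (L ⊗[k] (L ⊗[k] A)) → PierceSpec (L ⊗[k] A) :=
  PierceSpec.map (Algebra.TensorProduct.includeRight : L ⊗[k] A →ₐ[k] L ⊗[k] (L ⊗[k] A)).toRingHom

/-- `S` of the projection `(x₁, x₂, a) ↦ (x₁, a)`. -/
def pr₁₃ : PierceSpec (L ⊗[k] (L ⊗[k] A)) → PierceSpec (L ⊗[k] A) :=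
  PierceSpec.map (Algebra.TensorProduct.map (AlgHom.id k L)
    (Algebra.TensorProduct.includeRight : A →ₐ[k] L ⊗[k] A)).toRingHom

/-- The categorical Galois groupoid `S(L ⊗_k L) ⇉ S(L)` is a difference profinite group, with the
given group structure on `S(L ⊗_k L)`: there is one object, `S` preserves the fibre product of
composable pairs, the group operations are the structure maps of the groupoid, they are continuous
(the space is profinite, being a Pierce spectrum), and the difference operator is a
homomorphism. -/
structure IsCategoricalGaloisGroup [Group (GalSpace L)] : Prop where
  unique_object : Nonempty (Unique (PierceSpec L))
  composable : IsHomeomorph fun w : PierceSpec (L ⊗[k] (L ⊗[k] L)) => (pr₁₂ L L w, pr₂₃ L L w)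
  mul_eq : ∀ w, pr₁₂ L L w * pr₂₃ L L w = pr₁₃ L L w
  one_eq : ∀ x : PierceSpec L,
    1 = PierceSpec.map (Algebra.TensorProduct.lmul' k : L ⊗[k] L →ₐ[k] L).toRingHom x
  inv_eq : ∀ g : GalSpace L,
    g⁻¹ = PierceSpec.map (Algebra.TensorProduct.comm k L L).toAlgHom.toRingHom g
  isTopologicalGroup : IsTopologicalGroup (GalSpace L)
  map_mul : ∀ g h : GalSpace L, galσ L (g * h) = galσ L g * galσ L h

end Galois

/-! ### Spaces of homomorphisms -/

section Homs

variable {k : Type u} [CommRing k]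

/-- The topology of pointwise convergence on `Hom_k(A, B)`, with `B` discrete.  If `A` is a directed
union of subalgebras `A'` of finite dimension over a field `k` and `B` is a field, this is the
topology of the limit of the finite sets `Hom_k(A', B)`. -/
instance algHomTopology (A B : Type u) [CommRing A] [Algebra k A] [CommRing B] [Algebra k B] :
    TopologicalSpace (A →ₐ[k] B) :=
  TopologicalSpace.generateFrom {U | ∃ (a : A) (b : B), U = {f : A →ₐ[k] B | f a = b}}

variable {σk : k →+* k}

/-- The enriched hom `⟦A, B⟧_k`. -/
def IntHom (A B : DiffAlg k σk) : Type u :=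
  {f : ℕ → (A →ₐ[k] B) // ∀ (i : ℕ) (a : A), f i (A.σ a) = B.σ (f (i + 1) a)}

namespace IntHom

variable {A B C : DiffAlg k σk}

/-- The `n`-th component. -/
def comp (f : IntHom A B) (n : ℕ) : A →ₐ[k] B := f.1 n

/-- The topology with the subbasis of the sets `⟨a, b; n⟩ = {f | f_n(a) = b}`. -/
instance : TopologicalSpace (IntHom A B) :=
  TopologicalSpace.generateFrom
    {U | ∃ (a : A) (b : B) (n : ℕ), U = {f : IntHom A B | f.comp n a = b}}

/-- The shift, the difference operator of `⟦A, B⟧_k`. -/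
def shift (f : IntHom A B) : IntHom A B := ⟨fun n => f.1 (n + 1), fun i a => f.2 (i + 1) a⟩

/-- Componentwise composition `(g, f) ↦ (g_n ∘ f_n)`. -/
def mul (g : IntHom B C) (f : IntHom A B) : IntHom A C :=
  ⟨fun n => (g.1 n).comp (f.1 n), fun i a => by simp [f.2, g.2]⟩

end IntHom

/-- The underlying abstract group of the internal automorphism group `Aut⟦A⟧_k`. -/
def intAutSubgroup (A : DiffAlg k σk) : Subgroup (ℕ → (A ≃ₐ[k] A)) where
  carrier := {f | ∀ (i : ℕ) (a : A), f i (A.σ a) = A.σ (f (i + 1) a)}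
  mul_mem' {f g} hf hg i a := by
    simp only [Pi.mul_apply, AlgEquiv.mul_apply]
    rw [hg, hf]
  one_mem' _ _ := rfl
  inv_mem' {f} hf i a := by
    change (f i).symm (A.σ a) = A.σ ((f (i + 1)).symm a)
    rw [AlgEquiv.symm_apply_eq, hf, AlgEquiv.apply_symm_apply]

/-- The internal automorphism group `Aut⟦A⟧_k`: the elements of `⟦A, A⟧_k` all of whose components
are isomorphisms. -/
def IntAut (A : DiffAlg k σk) : Type u := intAutSubgroup A

namespace IntAut

variable {A : DiffAlg k σk}

instance : Group (IntAut A) := inferInstanceAs (Group (intAutSubgroup A))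

/-- The `n`-th component. -/
def comp (f : IntAut A) (n : ℕ) : A ≃ₐ[k] A := f.1 n

/-- The inclusion `Aut⟦A⟧_k ⊆ ⟦A, A⟧_k`. -/
def toIntHom (f : IntAut A) : IntHom A A := ⟨fun n => (f.1 n : A →ₐ[k] A), fun i a => f.2 i a⟩

instance : TopologicalSpace (IntAut A) := TopologicalSpace.induced toIntHom inferInstance

/-- The shift, the difference operator of `Aut⟦A⟧_k`. -/
def shift : IntAut A →* IntAut A where
  toFun f := ⟨fun n => f.1 (n + 1), fun i a => f.2 (i + 1) a⟩
  map_one' := rfl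
  map_mul' _ _ := rfl

end IntAut

end Homs

/-! ### Canonical maps and invariants -/

section Fields

variable {k : Type u} [Field k] {L : Type u} [Field L] [Algebra k L]

/-- The canonical map `Hom_k(A, L) → S₀(L ⊗_k A)`: it sends `f` to the point of the homomorphism
`L ⊗_k A → L`, `a ⊗ b ↦ a * f b`. -/
def toPierce {A : Type u} [CommRing A] [Algebra k A] (f : A →ₐ[k] L) : PierceSpec (L ⊗[k] A) :=
  PierceSpec.ofHom (Algebra.TensorProduct.productMap (AlgHom.id k L) f).toRingHom

variable {σk : k →+* k} {σL : L →+* L}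

/-- A difference field extension `(L, σL)` of `(k, σk)`, as a difference algebra. -/
abbrev extension (hσ : ∀ c : k, σL (algebraMap k L c) = algebraMap k L (σk c)) :
    DiffAlg k σk := ⟨L, σL, hσ⟩

variable (hσ : ∀ c : k, σL (algebraMap k L c) = algebraMap k L (σk c))
  {G : Type u} [Group G] [TopologicalSpace G] {σG : G → G} (ρ : G →* (L ≃ₐ[k] L))
  (hρ : ∀ (g : G) (x : L), ρ g (σL x) = σL (ρ (σG g) x))

/-- The invariants of `G` on the `k`-algebra `f_! C_L(X) = Cont(X, L)`, where `G` acts by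
`(g h)(x) = g (h (g⁻¹ x))`; the action of `G` on `L` is given by `ρ`. -/
def invariants (X : DiffProfAct G σG) : Subalgebra k (LocallyConstant X.toDiffProf L) where
  carrier := {h | ∀ (g : G) (x : X.toDiffProf), ρ g (h (g⁻¹ • x)) = h x}
  mul_mem' {a b} ha hb g x := by simp [ha g x, hb g x]
  add_mem' {a b} ha hb g x := by simp [ha g x, hb g x]
  algebraMap_mem' c g x := by simp

theorem invariants_iff (X : DiffProfAct G σG) (h : LocallyConstant X.toDiffProf L) :
    h ∈ invariants ρ X ↔ ∀ (g : G) (x : X.toDiffProf), h (g • x) = ρ g (h x) := by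
  constructor
  · intro H g x
    simpa using (H g (g • x)).symm
  · intro H g x
    rw [← H, smul_inv_smul]

theorem contσ_mem_invariants (hc : ∀ (g : G) (x : L), ρ g (σL x) = σL (ρ (σG g) x)) (X : DiffProfAct G σG) (h : LocallyConstant X.toDiffProf L)
    (hh : h ∈ invariants ρ X) : contσ (extension hσ) X.toDiffProf h ∈ invariants ρ X := by
  rw [invariants_iff] at hh ⊢
  intro g x
  change σL (h (X.σ (g • x))) = ρ g (σL (h (X.σ x)))
  rw [X.σ_smul, hc]
  exact congrArg σL (hh _ _)

/-- The functor `X ↦ (f_! C_L(X))^G` to difference `k`-algebras. -/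
def invariantsFunctor : (DiffProfAct G σG)ᵒᵖ ⥤ DiffAlg k σk where
  obj X :=
    { carrier := invariants ρ X.unop
      σ := (contσ (extension hσ) X.unop.toDiffProf).restrict (invariants ρ X.unop)
        (invariants ρ X.unop) (contσ_mem_invariants hσ ρ hρ X.unop)
      σ_algebraMap := fun c => by
        refine Subtype.ext (LocallyConstant.ext fun x => ?_)
        exact hσ c }
  map {X Y} φ :=
    { toAlgHom := ((LocallyConstant.comapₐ k φ.unop.toHom.toMap).comp
          (invariants ρ X.unop).val).codRestrict (invariants ρ Y.unop) (fun h => by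
            have := (invariants_iff ρ X.unop h.1).1 h.2
            rw [invariants_iff]
            intro g y
            change h.1 (φ.unop.toHom.toMap (g • y)) = ρ g (h.1 (φ.unop.toHom.toMap y))
            rw [φ.unop.smul, this])
      comm := fun h => by
        refine Subtype.ext (LocallyConstant.ext fun y => ?_)
        exact congrArg (fun z => σL (h.1 z)) (φ.unop.toHom.comm y).symm }
  map_id _ := rfl
  map_comp _ _ := rfl

end Fields

end DiffGalois

end

open DiffGalois

/-!
Write `B` for an algebra over the field `L` that is spanned by its idempotents (`IdemSpanned`).  For
a point `x` of `S(B)`, every `b : B` acts on some idempotent `e ∈ x` by a scalar, and this scalar is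
the value at `b` of a homomorphism `evalHom x : B → L`.  So the points of `S(B)` are the
`L`-algebra homomorphisms `B → L`, and the Gelfand transform `B → Cont(S(B), L)` is an isomorphism
(`evalAlgEquiv`).  An element of an
`L`-algebra annihilated by a separable split polynomial is a combination of idempotents, by Lagrange
interpolation; conversely the finitely many values of an element of `Cont(X, L)` are roots of a
product of distinct minimal polynomials over `k`.  Hence `A` is split
by `L` iff `L ⊗_k A` is spanned by idempotents, iff all elements of `A` are roots of separable
polynomials over `k` that split over `L`.

The characterisation of `evalHom` is stable under semilinear maps:
`evalHom x (σ b) = σ_L (evalHom (S(σ) x) b)` (`evalHom_map`).  This is why the difference structure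
imposes no extra condition on split algebras, and it provides the operators `()^σ`: for split `A`,
one has `Hom_k(A, L) ≃ S(L ⊗_k A)` (`homPierce`), and the operator `S(σ_L ⊗ σ_A)` on the right becomes
the `()^σ` with `f ∘ σ_A = σ_L ∘ f^σ` on the left.  As `σ_L` is injective, a sequence in `⟦A, L⟧_k`
is the sequence of iterates of `()^σ` on its zeroth term (`intHomHomeo`).  A point of
`S(L ⊗_k L ⊗_k A)` is `a ⊗ b ⊗ c ↦ a g(b) g(f(c))` for a unique pair of `g ∈ Gal(L/k)` and
`f : A → L`, and its three projections are `g`, `f` and `g ∘ f`; thus the groupoid structure is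
composition.

For the equivalence, let `G ≃ Gal(L/k)`.  The unit `A → Cont(S(L ⊗_k A), L)^G` is bijective by
Galois descent: the invariants of `L ⊗_k A` under `Gal(L/k)` acting on `L` are `A`
(`exists_eq_one_tmul`).  The counit `X → S(L ⊗_k Cont(X, L)^G)` sends `x` to evaluation at `x`.  It
is bijective because there are enough invariant functions (`exists_equivariant_ne`): a clopen
`U ⊆ X` is stable under `Gal(L/E)` for a finite normal `E/k`, the traces over `Gal(E/k)` of the
functions `c · 1_U` with `c ∈ E` are invariant, and by Dedekind's independence of characters they
detect whether a point lies in `U`.  This gives injectivity on `X`; applied to `S(L ⊗_k A)` with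
`A = Cont(X, L)^G` it shows that the closed stable image of `X` is everything, for otherwise some
nonzero function in `A` would vanish at every point of `X`.
-/

noncomputable section

namespace DiffGalois

/-! ### Points and clopen subsets of the Pierce spectrum -/

namespace PierceSpec

variable {R R' : Type u} [CommRing R] [CommRing R'] {F F' : Type u} [Field F] [Field F']

theorem mem_ofHom {φ : R →+* F} {e : R} :
    e ∈ (ofHom φ).carrier ↔ IsIdempotentElem e ∧ φ e = 1 := Iff.rfl

theorem map_ofHom (φ : R →+* R') (ψ : R' →+* F) : map φ (ofHom ψ) = ofHom (ψ.comp φ) :=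
  PierceSpec.ext (Set.ext fun _ => ⟨fun h => ⟨h.1, h.2.2⟩, fun h => ⟨h.1, h.1.map φ, h.2⟩⟩)

theorem ofHom_comp (φ : R →+* F) (g : F →+* F') : ofHom (g.comp φ) = ofHom φ :=
  PierceSpec.ext (Set.ext fun e => by
    simp [mem_ofHom, map_eq_one_iff g g.injective])

theorem mul_mem_iff (x : PierceSpec R) {e e' : R} (he : IsIdempotentElem e)
    (he' : IsIdempotentElem e') : e * e' ∈ x.carrier ↔ e ∈ x.carrier ∧ e' ∈ x.carrier :=
  ⟨fun h => ⟨x.upward e' e h he, x.upward e e' (by rwa [mul_comm]) he'⟩,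
    fun h => x.mul_mem _ h.1 _ h.2⟩

/-- The residue field at a maximal ideal containing `I` gives an ultrafilter avoiding `I`. -/
theorem exists_forall_notMem (I : Ideal R) (hI : I ≠ ⊤) :
    ∃ x : PierceSpec R, ∀ e ∈ I, e ∉ x.carrier := by
  obtain ⟨m, hm, hIm⟩ := Ideal.exists_le_maximal I hI
  let := Ideal.Quotient.field m
  refine ⟨ofHom (Ideal.Quotient.mk m), fun e he h => ?_⟩
  have := h.2
  rw [Ideal.Quotient.eq_zero_iff_mem.2 (hIm he)] at this
  exact zero_ne_one this

theorem isTopologicalBasis : TopologicalSpace.IsTopologicalBasis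
    {U | ∃ e : R, IsIdempotentElem e ∧ U = {x : PierceSpec R | e ∈ x.carrier}} := by
  refine ⟨?_, ?_, rfl⟩
  · rintro _ ⟨e, he, rfl⟩ _ ⟨e', he', rfl⟩ x hx
    exact ⟨_, ⟨e * e', he.mul he', rfl⟩, (x.mul_mem_iff he he').2 hx,
      fun y hy => (y.mul_mem_iff he he').1 hy⟩
  · exact Set.eq_univ_of_forall fun x => ⟨_, ⟨1, IsIdempotentElem.one, rfl⟩, x.one_mem⟩

/-- Stone duality for idempotents: the clopen subsets of `S(R)` are the basic ones. -/
theorem exists_eq_of_isClopen {U : Set (PierceSpec R)} (hU : IsClopen U) :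
    ∃ e : R, IsIdempotentElem e ∧ U = {x | e ∈ x.carrier} := by
  suffices ∃ e : R, IsIdempotentElem e ∧ U ⊆ {x | e ∈ x.carrier} ∧ {x | e ∈ x.carrier} ⊆ U by
    obtain ⟨e, he, h1, h2⟩ := this
    exact ⟨e, he, h1.antisymm h2⟩
  refine hU.1.isCompact.induction_on (p := fun s => ∃ e : R, IsIdempotentElem e ∧
    s ⊆ {x | e ∈ x.carrier} ∧ {x | e ∈ x.carrier} ⊆ U) ?_ ?_ ?_ ?_
  · exact ⟨0, IsIdempotentElem.zero, Set.empty_subset _, fun x hx => (x.zero_notMem hx).elim⟩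
  · rintro s t hst ⟨e, he, h1, h2⟩
    exact ⟨e, he, hst.trans h1, h2⟩
  · rintro s t ⟨e, he, h1, h2⟩ ⟨e', he', h1', h2'⟩
    have hi := (he.one_sub.mul he'.one_sub).one_sub
    have key : ∀ x : PierceSpec R, 1 - (1 - e) * (1 - e') ∈ x.carrier ↔
        e ∈ x.carrier ∨ e' ∈ x.carrier := fun x => by
      rw [x.one_sub_mem_iff (he.one_sub.mul he'.one_sub), x.mul_mem_iff he.one_sub he'.one_sub,
        x.one_sub_mem_iff he, x.one_sub_mem_iff he']
      tauto
    exact ⟨_, hi, Set.union_subset (fun x hx => (key x).2 (Or.inl (h1 hx)))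
      fun x hx => (key x).2 (Or.inr (h1' hx)), fun x hx => ((key x).1 hx).elim (@h2 x) (@h2' x)⟩
  · intro x hx
    obtain ⟨_, ⟨e, he, rfl⟩, hxe, heU⟩ := isTopologicalBasis.exists_subset_of_mem_open hx hU.2
    exact ⟨_, mem_nhdsWithin_of_mem_nhds ((isOpen_basic he).mem_nhds hxe), e, he, subset_rfl, heU⟩

instance uniqueOfField : Unique (PierceSpec F) where
  default := ofHom (RingHom.id F)
  uniq x := by
    refine PierceSpec.ext (Set.ext fun e => ⟨fun h => ⟨x.idem e h, ?_⟩, ?_⟩)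
    · rcases IsIdempotentElem.iff_eq_zero_or_one.1 (x.idem e h) with h0 | h1
      · exact absurd (h0 ▸ h) x.zero_notMem
      · exact h1
    · rintro ⟨_, h : e = 1⟩
      exact h ▸ x.one_mem

end PierceSpec

/-! ### Algebras spanned by idempotents -/

/-- The `L`-algebra `B` is generated, equivalently spanned (`IdemSpanned.span_eq_top`), by its
idempotents.  Over a field `L` these are the algebras isomorphic to `Cont(X, L)` for some
profinite `X`. -/
def IdemSpanned (L B : Type u) [Field L] [CommRing B] [Algebra L B] : Prop :=
  Algebra.adjoin L {e : B | IsIdempotentElem e} = ⊤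

section IdemSpanned

variable {L B B' : Type u} [Field L] [CommRing B] [Algebra L B] [CommRing B'] [Algebra L B']

theorem IdemSpanned.span_eq_top (h : IdemSpanned L B) :
    Submodule.span L {e : B | IsIdempotentElem e} = ⊤ := by
  have hcl : ((Submonoid.closure {e : B | IsIdempotentElem e} : Submonoid B) : Set B) =
      {e : B | IsIdempotentElem e} := by
    refine Set.Subset.antisymm ?_ Submonoid.subset_closure
    intro e he
    induction he using Submonoid.closure_induction with
    | mem x hx => exact hx
    | one => exact IsIdempotentElem.one
    | mul x y _ _ hx hy => exact IsIdempotentElem.mul hx hy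
  have := Algebra.adjoin_eq_span (R := L) {e : B | IsIdempotentElem e}
  rw [hcl, h, Algebra.top_toSubmodule] at this
  exact this.symm

theorem IdemSpanned.apply_mem_adjoin (h : IdemSpanned L B) (φ : B →ₐ[L] B') (b : B) :
    φ b ∈ Algebra.adjoin L {e : B' | IsIdempotentElem e} := by
  have hb : b ∈ Algebra.adjoin L {e : B | IsIdempotentElem e} := by
    rw [h]; exact Algebra.mem_top
  have := Subalgebra.mem_map.2 ⟨b, hb, (rfl : φ b = φ b)⟩
  rw [AlgHom.map_adjoin] at this
  refine Algebra.adjoin_mono ?_ this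
  rintro _ ⟨e, he, rfl⟩
  exact IsIdempotentElem.map he φ

theorem IdemSpanned.congr (h : IdemSpanned L B) (φ : B ≃ₐ[L] B') : IdemSpanned L B' := by
  rw [IdemSpanned, eq_top_iff]
  intro b _
  simpa using h.apply_mem_adjoin (φ : B →ₐ[L] B') (φ.symm b)

theorem idemSpanned_locallyConstant (X : Type u) [TopologicalSpace X] [CompactSpace X] :
    IdemSpanned L (LocallyConstant X L) := by
  classical
  rw [IdemSpanned, eq_top_iff]
  intro h _
  have hfin := h.range_finite
  have hc : ∀ c : L, IsClopen (h ⁻¹' {c}) := fun c => h.2.isClopen_fiber c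
  have : h = ∑ c ∈ hfin.toFinset, c • LocallyConstant.charFn L (hc c) := by
    refine LocallyConstant.ext fun x => ?_
    have happ : ∀ s : Finset L, (∑ c ∈ s, c • LocallyConstant.charFn L (hc c)) x =
        ∑ c ∈ s, c * Set.indicator (h ⁻¹' {c}) 1 x := fun s => by
      induction s using Finset.induction_on with
      | empty => simp
      | insert c s hcs ih => rw [Finset.sum_insert hcs, Finset.sum_insert hcs, ← ih]; rfl
    rw [happ, Finset.sum_eq_single (h x)]
    · simp
    · intro c _ hne
      simp [Set.indicator, hne.symm]
    · intro hx
      simp at hx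
  rw [this]
  refine Subalgebra.sum_mem _ fun c _ => Subalgebra.smul_mem _ (Algebra.subset_adjoin ?_) c
  refine LocallyConstant.ext fun x => ?_
  change LocallyConstant.charFn L (hc c) x * LocallyConstant.charFn L (hc c) x = _
  rw [LocallyConstant.coe_charFn]
  by_cases hx : x ∈ h ⁻¹' {c} <;> simp only [Set.indicator, hx, if_true, if_false] <;> simp

variable (hB : IdemSpanned L B)

include hB in
theorem IdemSpanned.exists_mul_eq_smul (x : PierceSpec B) (b : B) :
    ∃ c : L, ∃ e ∈ x.carrier, e * b = c • e := by
  have hb : b ∈ Submodule.span L {e : B | IsIdempotentElem e} := by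
    rw [hB.span_eq_top]; trivial
  induction hb using Submodule.span_induction with
  | mem b hb =>
    rcases x.mem_or b hb with h | h
    · exact ⟨1, b, h, by rw [one_smul]; exact hb⟩
    · exact ⟨0, 1 - b, h, by rw [sub_mul, one_mul, zero_smul, hb.eq, sub_self]⟩
  | zero => exact ⟨0, 1, x.one_mem, by simp⟩
  | add a b _ _ ha hb =>
    obtain ⟨c, e, he, h⟩ := ha
    obtain ⟨c', e', he', h'⟩ := hb
    refine ⟨c + c', e * e', x.mul_mem _ he _ he', ?_⟩
    rw [mul_add, mul_right_comm, h, mul_assoc, h', add_smul, smul_mul_assoc, mul_smul_comm]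
  | smul l b _ hb =>
    obtain ⟨c, e, he, h⟩ := hb
    exact ⟨l * c, e, he, by rw [mul_smul_comm, h, smul_smul]⟩

theorem eq_of_mul_eq_smul (x : PierceSpec B) {b e e' : B} {c c' : L} (he : e ∈ x.carrier)
    (he' : e' ∈ x.carrier) (h : e * b = c • e) (h' : e' * b = c' • e') : c = c' := by
  have hne : e * e' ≠ 0 := fun h0 => x.zero_notMem (h0 ▸ x.mul_mem _ he _ he')
  by_contra hcc
  have h1 : (c - c') • (e * e') = 0 := by
    rw [sub_smul, ← smul_mul_assoc, ← h, ← mul_smul_comm, ← h']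
    ring
  exact hne ((smul_eq_zero.1 h1).resolve_left (sub_ne_zero.2 hcc))

/-- The `L`-algebra homomorphism `B → L` attached to a point `x` of `S(B)`, for `B` spanned by
idempotents: the value at `b` is the scalar by which `b` acts on some idempotent of `x`. -/
def evalHom (x : PierceSpec B) : B →ₐ[L] L :=
  have key := fun b => (hB.exists_mul_eq_smul x b).choose_spec
  AlgHom.ofLinearMap
    { toFun := fun b => (hB.exists_mul_eq_smul x b).choose
      map_add' := fun a b => by
        obtain ⟨e, he, h⟩ := key a
        obtain ⟨e', he', h'⟩ := key b
        obtain ⟨e'', he'', h''⟩ := key (a + b)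
        refine eq_of_mul_eq_smul x he'' (x.mul_mem _ he _ he') h'' ?_
        rw [mul_add, mul_right_comm, h, mul_assoc, h', add_smul, smul_mul_assoc, mul_smul_comm]
      map_smul' := fun l b => by
        obtain ⟨e, he, h⟩ := key b
        obtain ⟨e'', he'', h''⟩ := key (l • b)
        refine eq_of_mul_eq_smul x he'' he h'' ?_
        rw [mul_smul_comm, h, smul_smul]; rfl }
    (by
      obtain ⟨e, he, h⟩ := key 1
      exact eq_of_mul_eq_smul x he x.one_mem h (by simp))
    (fun a b => by
      obtain ⟨e, he, h⟩ := key a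
      obtain ⟨e', he', h'⟩ := key b
      obtain ⟨e'', he'', h''⟩ := key (a * b)
      refine eq_of_mul_eq_smul x he'' (x.mul_mem _ he _ he') h'' ?_
      rw [mul_mul_mul_comm, h, h', smul_mul_smul_comm]; rfl)

theorem evalHom_eq_iff {x : PierceSpec B} {b : B} {c : L} :
    evalHom hB x b = c ↔ ∃ e ∈ x.carrier, e * b = c • e := by
  obtain ⟨e, he, h⟩ := (hB.exists_mul_eq_smul x b).choose_spec
  constructor
  · rintro rfl
    exact ⟨e, he, h⟩
  · rintro ⟨e', he', h'⟩
    exact eq_of_mul_eq_smul x he he' h h'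

theorem evalHom_eq_one_iff {x : PierceSpec B} {e : B} (he : IsIdempotentElem e) :
    evalHom hB x e = 1 ↔ e ∈ x.carrier := by
  constructor
  · intro h
    by_contra hx
    have h1 : evalHom hB x (1 - e) = 1 :=
      (evalHom_eq_iff hB).2 ⟨_, (x.one_sub_mem_iff he).2 hx, by rw [he.one_sub.eq, one_smul]⟩
    rw [map_sub, map_one, h, sub_self] at h1
    exact zero_ne_one h1
  · intro h
    exact (evalHom_eq_iff hB).2 ⟨e, h, by rw [he.eq, one_smul]⟩

@[simp]
theorem ofHom_evalHom (x : PierceSpec B) : PierceSpec.ofHom (evalHom hB x).toRingHom = x :=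
  PierceSpec.ext (Set.ext fun e => ⟨fun h => (evalHom_eq_one_iff hB h.1).1 h.2,
    fun h => ⟨x.idem e h, (evalHom_eq_one_iff hB (x.idem e h)).2 h⟩⟩)

@[simp]
theorem evalHom_ofHom (φ : B →ₐ[L] L) : evalHom hB (PierceSpec.ofHom φ.toRingHom) = φ := by
  refine AlgHom.ext fun b => ?_
  obtain ⟨e, ⟨_, he⟩, h⟩ := (evalHom_eq_iff hB).1 (rfl : evalHom hB (.ofHom φ.toRingHom) b = _)
  have he' : φ e = 1 := he
  have := congrArg φ h
  rw [map_mul, map_smul, he', one_mul, smul_eq_mul, mul_one] at this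
  exact this.symm

/-- Evaluation at the points of `S(B)` is compatible with semilinear ring homomorphisms. -/
theorem evalHom_map (hB' : IdemSpanned L B') (σ : L →+* L) (φ : B →+* B')
    (hφ : ∀ c b, φ (c • b) = σ c • φ b) (x : PierceSpec B') (b : B) :
    evalHom hB' x (φ b) = σ (evalHom hB (PierceSpec.map φ x) b) := by
  obtain ⟨e, he, h⟩ :=
    (evalHom_eq_iff hB).1 (rfl : evalHom hB (PierceSpec.map φ x) b = _)
  exact (evalHom_eq_iff hB').2 ⟨φ e, he.2, by rw [← map_mul, h, hφ]⟩

theorem isOpen_evalHom_eq (b : B) (c : L) : IsOpen {x | evalHom hB x b = c} := by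
  refine isOpen_iff_mem_nhds.2 fun x hx => ?_
  obtain ⟨e, he, h⟩ := (evalHom_eq_iff hB).1 hx
  exact Filter.mem_of_superset ((PierceSpec.isOpen_basic (x.idem e he)).mem_nhds he)
    fun y hy => (evalHom_eq_iff hB).2 ⟨e, hy, h⟩

/-- The Gelfand transform `B → Cont(S(B), L)`. -/
def evalAlgHom : B →ₐ[L] LocallyConstant (PierceSpec B) L where
  toFun b := ⟨fun x => evalHom hB x b, IsLocallyConstant.iff_exists_open _ |>.2 fun x =>
    ⟨_, isOpen_evalHom_eq hB b (evalHom hB x b), rfl, fun _ h => h⟩⟩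
  map_one' := LocallyConstant.ext fun x => map_one (evalHom hB x)
  map_mul' a b := LocallyConstant.ext fun x => map_mul (evalHom hB x) a b
  map_zero' := LocallyConstant.ext fun x => map_zero (evalHom hB x)
  map_add' a b := LocallyConstant.ext fun x => map_add (evalHom hB x) a b
  commutes' c := LocallyConstant.ext fun x => (evalHom hB x).commutes c

theorem evalAlgHom_injective : Function.Injective (evalAlgHom hB) := by
  rw [injective_iff_map_eq_zero]
  intro b hb
  -- The annihilator of `b` meets every ultrafilter, hence is not contained in a maximal ideal.
  by_contra hne
  obtain ⟨x, hx⟩ := PierceSpec.exists_forall_notMem (LinearMap.ker (LinearMap.mulRight B b))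
    (fun h => hne (by
      have : (1 : B) ∈ LinearMap.ker (LinearMap.mulRight B b) := h ▸ Submodule.mem_top
      simpa using this))
  obtain ⟨e, he, h⟩ := (evalHom_eq_iff hB).1
    (DFunLike.congr_fun hb x : evalHom hB x b = 0)
  exact hx e (by simpa using h) he

theorem evalAlgHom_surjective : Function.Surjective (evalAlgHom hB) := by
  rw [← AlgHom.range_eq_top, eq_top_iff, ← idemSpanned_locallyConstant (L := L) (PierceSpec B),
    Algebra.adjoin_le_iff]
  intro h hh
  obtain ⟨e, he, hU⟩ := PierceSpec.exists_eq_of_isClopen (h.2.isClopen_fiber 1)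
  refine ⟨e, LocallyConstant.ext fun x => ?_⟩
  have h01 : ∀ y : PierceSpec B, h y = 0 ∨ h y = 1 := fun y =>
    IsIdempotentElem.iff_eq_zero_or_one.1 (DFunLike.congr_fun hh y : h y * h y = h y)
  have he01 := IsIdempotentElem.iff_eq_zero_or_one.1 (he.map (evalHom hB x))
  have hiff : h x = 1 ↔ evalHom hB x e = 1 := by
    rw [evalHom_eq_one_iff hB he]
    exact Set.ext_iff.1 hU x
  change evalHom hB x e = h x
  rcases h01 x with h0 | h1
  · rcases he01 with h2 | h2
    · rw [h0, h2]
    · exact absurd (hiff.2 h2) (by rw [h0]; exact zero_ne_one)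
  · rw [h1, hiff.1 h1]

/-- An `L`-algebra spanned by idempotents is `Cont(X, L)` for `X` its Pierce spectrum. -/
def evalAlgEquiv : B ≃ₐ[L] LocallyConstant (PierceSpec B) L :=
  AlgEquiv.ofBijective (evalAlgHom hB) ⟨evalAlgHom_injective hB, evalAlgHom_surjective hB⟩

end IdemSpanned

/-! ### Split algebras and roots of separable polynomials -/

section SplitElem

open Polynomial

/-- Lagrange interpolation: a root of a separable split polynomial is a combination of
idempotents. -/
theorem mem_adjoin_idem_of_aeval_eq_zero {L B : Type u} [Field L] [CommRing B] [Algebra L B]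
    {p : L[X]} (hsep : p.Separable) (hsplit : p.Splits) {b : B} (hb : aeval b p = 0) :
    b ∈ Algebra.adjoin L {e : B | IsIdempotentElem e} := by
  classical
  let s : Finset L := p.roots.toFinset
  have hdvd : ∀ f : L[X], (∀ c ∈ s, f.eval c = 0) → aeval b f = 0 := fun f hf => by
    by_cases hf0 : f = 0
    · rw [hf0, map_zero]
    obtain ⟨q, rfl⟩ : p ∣ f := hsplit.dvd_of_roots_le_roots hsep.ne_zero
      ((Multiset.le_iff_subset (nodup_roots hsep)).2 fun c hc =>
        (mem_roots hf0).2 (hf c (Multiset.mem_toFinset.2 hc)))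
    rw [map_mul, hb, zero_mul]
  have hbasis : ∀ c ∈ s, ∀ d ∈ s,
      (Lagrange.basis s id c).eval d = if c = d then 1 else 0 := fun c hc d hd => by
    split_ifs with h
    · rw [← h]
      exact Lagrange.eval_basis_self (Function.injective_id.injOn) hc
    · exact Lagrange.eval_basis_of_ne (v := id) h hd
  have hidem : ∀ c ∈ s, IsIdempotentElem (aeval b (Lagrange.basis s id c)) := fun c hc => by
    have := hdvd (Lagrange.basis s id c * Lagrange.basis s id c - Lagrange.basis s id c)
      fun d hd => by
        rw [eval_sub, eval_mul, hbasis c hc d hd]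
        split_ifs <;> simp
    rwa [map_sub, map_mul, sub_eq_zero] at this
  have hsum := hdvd (X - ∑ c ∈ s, C c * Lagrange.basis s id c) fun d hd => by
    rw [eval_sub, eval_X, eval_finsetSum, Finset.sum_eq_single d, eval_mul, eval_C,
      hbasis d hd d hd, if_pos rfl, mul_one, sub_self]
    · intro c hc hcd
      rw [eval_mul, hbasis c hc d hd, if_neg hcd, mul_zero]
    · exact fun h => absurd hd h
  rw [map_sub, aeval_X, sub_eq_zero] at hsum
  rw [hsum, map_sum]
  refine Subalgebra.sum_mem _ fun c hc => ?_
  rw [map_mul, aeval_C]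
  exact Subalgebra.mul_mem _ (Subalgebra.algebraMap_mem _ c)
    (Algebra.subset_adjoin (hidem c hc))

variable {k L : Type u} [Field k] [Field L] [Algebra k L]

theorem IsSplitElem.of_injective {A B : Type u} [CommRing A] [Algebra k A] [CommRing B]
    [Algebra k B] (h : IsSplitElem k L B) (φ : A →ₐ[k] B) (hφ : Function.Injective φ) :
    IsSplitElem k L A := fun a => by
  obtain ⟨p, hp, hsep, hsplit⟩ := h (φ a)
  refine ⟨p, hφ ?_, hsep, hsplit⟩
  rw [map_zero, ← hp, aeval_algHom_apply]

theorem IsSplitElem.idemSpanned {A : Type u} [CommRing A] [Algebra k A]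
    (h : IsSplitElem k L A) : IdemSpanned L (L ⊗[k] A) := by
  rw [IdemSpanned, eq_top_iff]
  intro z _
  induction z using TensorProduct.induction_on with
  | zero => exact Subalgebra.zero_mem _
  | add x y hx hy => exact Subalgebra.add_mem _ (hx trivial) (hy trivial)
  | tmul l a =>
    obtain ⟨p, hp, hsep, hsplit⟩ := h a
    have h1 : l ⊗ₜ[k] a = l • (1 ⊗ₜ[k] a : L ⊗[k] A) := by
      rw [TensorProduct.smul_tmul', smul_eq_mul, mul_one]
    rw [h1]
    refine Subalgebra.smul_mem _ (mem_adjoin_idem_of_aeval_eq_zero hsep.map hsplit ?_) l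
    rw [aeval_map_algebraMap]
    have : (1 ⊗ₜ[k] a : L ⊗[k] A) =
      (Algebra.TensorProduct.includeRight : A →ₐ[k] L ⊗[k] A) a := rfl
    rw [this, aeval_algHom_apply, hp, map_zero]

theorem isSplitElem_locallyConstant [IsGalois k L] (X : Type u) [TopologicalSpace X]
    [CompactSpace X] : IsSplitElem k L (LocallyConstant X L) := by
  classical
  intro h
  -- The values of `h` are roots of the product of their distinct minimal polynomials over `k`.
  have hint : ∀ c : L, IsIntegral k c := fun c => Algebra.IsIntegral.isIntegral c
  refine ⟨∏ q ∈ h.range_finite.toFinset.image (minpoly k), q, ?_, ?_, ?_⟩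
  · refine LocallyConstant.ext fun x => ?_
    change LocallyConstant.evalₐ k x (aeval h _) = 0
    rw [← aeval_algHom_apply, map_prod]
    refine Finset.prod_eq_zero (i := minpoly k (h x))
      (Finset.mem_image_of_mem _ (by simp)) ?_
    exact minpoly.aeval k (h x)
  · refine separable_prod' ?_ ?_
    · intro p hp q hq hpq
      obtain ⟨c, -, rfl⟩ := Finset.mem_image.1 hp
      obtain ⟨d, -, rfl⟩ := Finset.mem_image.1 hq
      refine (minpoly.irreducible (hint c)).coprime_iff_not_dvd.2 fun hdvd => hpq ?_
      exact eq_of_monic_of_associated (minpoly.monic (hint c)) (minpoly.monic (hint d))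
        ((minpoly.irreducible (hint c)).associated_of_dvd (minpoly.irreducible (hint d)) hdvd)
    · intro p hp
      obtain ⟨c, -, rfl⟩ := Finset.mem_image.1 hp
      exact Algebra.IsSeparable.isSeparable k c
  · rw [Polynomial.map_prod]
    refine Splits.prod fun p hp => ?_
    obtain ⟨c, -, rfl⟩ := Finset.mem_image.1 hp
    exact Normal.splits inferInstance c

theorem idemSpanned_iff_isSplitBy {A : Type u} [CommRing A] [Algebra k A] :
    IdemSpanned L (L ⊗[k] A) ↔ IsSplitBy k L A := by
  constructor
  · intro h
    exact ⟨Profinite.of (PierceSpec (L ⊗[k] A)), ⟨evalAlgEquiv h⟩⟩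
  · rintro ⟨X, ⟨e⟩⟩
    exact (idemSpanned_locallyConstant X).congr e.symm

theorem isSplitBy_iff_isSplitElem [IsGalois k L] {A : Type u} [CommRing A] [Algebra k A] :
    IsSplitBy k L A ↔ IsSplitElem k L A := by
  refine ⟨?_, fun h => idemSpanned_iff_isSplitBy.1 h.idemSpanned⟩
  rintro ⟨X, ⟨e⟩⟩
  have : IsScalarTower k L (LocallyConstant X L) :=
    ⟨fun a b h => LocallyConstant.ext fun x => smul_assoc a b (h x)⟩
  refine (isSplitElem_locallyConstant (k := k) (L := L) X).of_injective
    ((e.toAlgHom.restrictScalars k).comp Algebra.TensorProduct.includeRight) ?_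
  exact e.injective.comp
    (Algebra.TensorProduct.includeRight_injective (algebraMap k L).injective)

theorem isSplitElem_self [IsGalois k L] : IsSplitElem k L L := fun c =>
  ⟨minpoly k c, minpoly.aeval k c, Algebra.IsSeparable.isSeparable k c,
    Normal.splits inferInstance c⟩

end SplitElem

/-! ### Split difference algebras -/

namespace DiffAlg

variable {k : Type u} [CommRing k] {σk : k →+* k} {A B : DiffAlg k σk}

/-- An algebra isomorphism commuting with the `σ`s, as an isomorphism of difference algebras. -/
def isoMk (e : A ≃ₐ[k] B) (he : ∀ a : A, e (A.σ a) = B.σ (e a)) : A ≅ B where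
  hom := ⟨e, he⟩
  inv := ⟨e.symm, fun b => e.injective (by
    change e (e.symm (B.σ b)) = e (A.σ (e.symm b))
    rw [he, e.apply_symm_apply, e.apply_symm_apply])⟩
  hom_inv_id := Hom.ext (AlgHom.ext e.symm_apply_apply)
  inv_hom_id := Hom.ext (AlgHom.ext e.apply_symm_apply)

/-- The algebra isomorphism underlying an isomorphism of difference algebras. -/
def algEquivOfIso (e : A ≅ B) : A ≃ₐ[k] B :=
  AlgEquiv.ofAlgHom (Hom.toAlgHom e.hom) (Hom.toAlgHom e.inv)
    (congrArg Hom.toAlgHom e.inv_hom_id) (congrArg Hom.toAlgHom e.hom_inv_id)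

end DiffAlg

section IsSplit

variable {k L : Type u} [Field k] [Field L] [Algebra k L] {σk : k →+* k} {σL : L →+* L}
  (hσ : ∀ c : k, σL (algebraMap k L c) = algebraMap k L (σk c))

theorem tensorσ_tmul (A : DiffAlg k σk) (l : L) (a : A) :
    tensorσ (extension hσ) A (l ⊗ₜ[k] a : L ⊗[k] A) = (σL l ⊗ₜ[k] A.σ a : L ⊗[k] A) := by
  simp [tensorσ]

theorem tensorσ_smul (A : DiffAlg k σk) (c : L) (b : L ⊗[k] A) :
    tensorσ (extension hσ) A (c • b) = σL c • tensorσ (extension hσ) A b := by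
  induction b using TensorProduct.induction_on with
  | zero => simp
  | add x y hx hy => rw [smul_add, map_add, hx, hy, map_add, smul_add]
  | tmul l a =>
    rw [TensorProduct.smul_tmul', smul_eq_mul, tensorσ_tmul, tensorσ_tmul,
      TensorProduct.smul_tmul', smul_eq_mul, map_mul]

/-- The difference structure imposes no condition: `S(σ_L ⊗ σ_A)` makes the Gelfand transform a
morphism of difference algebras. -/
theorem isSplit_iff_isSplitBy (A : DiffAlg k σk) :
    IsSplit (extension hσ) A ↔ IsSplitBy k L A := by
  constructor
  · rintro ⟨X, ⟨e⟩⟩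
    exact ⟨Profinite.of X, ⟨DiffAlg.algEquivOfIso e⟩⟩
  · intro h
    have hB := idemSpanned_iff_isSplitBy.2 h
    let e : L ⊗[k] A ≃ₐ[L] LocallyConstant (PierceSpec (L ⊗[k] A)) L := evalAlgEquiv hB
    refine ⟨(pierce (extension hσ)).obj (op A), ⟨DiffAlg.isoMk
      (k := L) (σk := σL) (A := baseChange (extension hσ) A)
      (B := contAlg (extension hσ) ((pierce (extension hσ)).obj (op A)))
      e fun b => ?_⟩⟩
    exact LocallyConstant.ext fun x => evalHom_map hB hB σL (tensorσ (extension hσ) A)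
      (tensorσ_smul hσ A) x b

theorem IsSplit.idemSpanned {A : DiffAlg k σk} (h : IsSplit (extension hσ) A) :
    IdemSpanned L (L ⊗[k] A) :=
  idemSpanned_iff_isSplitBy.2 ((isSplit_iff_isSplitBy hσ A).1 h)

end IsSplit

/-! ### Homomorphisms to `L` as points of the Pierce spectrum -/

section Points

variable {k L : Type u} [Field k] [Field L] [Algebra k L]

theorem map_toPierce {A B : Type u} [CommRing A] [Algebra k A] [CommRing B] [Algebra k B]
    (φ : A →ₐ[k] B) (f : B →ₐ[k] L) :
    PierceSpec.map (Algebra.TensorProduct.map (AlgHom.id k L) φ).toRingHom (toPierce f) =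
      toPierce (f.comp φ) := by
  refine (PierceSpec.map_ofHom _ _).trans (congrArg PierceSpec.ofHom (RingHom.ext fun z => ?_))
  have : (Algebra.TensorProduct.productMap (AlgHom.id k L) f).comp
      (Algebra.TensorProduct.map (AlgHom.id k L) φ) =
        Algebra.TensorProduct.productMap (AlgHom.id k L) (f.comp φ) := by
    ext <;> simp
  exact DFunLike.congr_fun this z

variable {A : Type u} [CommRing A] [Algebra k A]

theorem isLocallyConstant_apply (a : A) : IsLocallyConstant fun f : A →ₐ[k] L => f a :=
  IsLocallyConstant.iff_exists_open _ |>.2 fun f =>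
    ⟨_, TopologicalSpace.isOpen_generateFrom_of_mem ⟨a, f a, rfl⟩, rfl, fun _ h => h⟩

theorem isLocallyConstant_productMap (z : L ⊗[k] A) : IsLocallyConstant fun f : A →ₐ[k] L =>
    Algebra.TensorProduct.productMap (AlgHom.id k L) f z := by
  induction z using TensorProduct.induction_on with
  | zero =>
    simp only [map_zero]
    exact IsLocallyConstant.const 0
  | tmul l a => exact (isLocallyConstant_apply a).comp (l * ·)
  | add x y hx hy =>
    simp only [map_add]
    exact hx.add hy

theorem continuous_toPierce : Continuous (toPierce : (A →ₐ[k] L) → PierceSpec (L ⊗[k] A)) := by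
  refine continuous_generateFrom_iff.2 ?_
  rintro _ ⟨e, he, rfl⟩
  convert (isLocallyConstant_productMap (L := L) e).isOpen_fiber 1 using 1
  ext f
  exact ⟨fun h => h.2, fun h => ⟨he, h⟩⟩

theorem toPierce_eq_ofHom (f : A →ₐ[k] L) : toPierce f = PierceSpec.ofHom
    (Algebra.TensorProduct.productLeftAlgHom (AlgHom.id L L) f).toRingHom := rfl

variable (h : IdemSpanned L (L ⊗[k] A))

theorem evalHom_toPierce (f : A →ₐ[k] L) :
    evalHom h (toPierce f) = Algebra.TensorProduct.productLeftAlgHom (AlgHom.id L L) f := by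
  rw [toPierce_eq_ofHom, evalHom_ofHom]

/-- The homomorphism `A → L` attached to a point of `S(L ⊗_k A)`. -/
def pointHom (x : PierceSpec (L ⊗[k] A)) : A →ₐ[k] L :=
  ((evalHom h x).restrictScalars k).comp Algebra.TensorProduct.includeRight

theorem pointHom_apply (x : PierceSpec (L ⊗[k] A)) (a : A) :
    pointHom h x a = evalHom h x (1 ⊗ₜ a) := rfl

@[simp]
theorem pointHom_toPierce (f : A →ₐ[k] L) : pointHom h (toPierce f) = f :=
  AlgHom.ext fun a => by simp [pointHom_apply, evalHom_toPierce]

@[simp]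
theorem toPierce_pointHom (x : PierceSpec (L ⊗[k] A)) : toPierce (pointHom h x) = x := by
  have : Algebra.TensorProduct.productLeftAlgHom (AlgHom.id L L) (pointHom h x) = evalHom h x := by
    ext a
    simp [pointHom_apply]
  rw [toPierce_eq_ofHom, this, ofHom_evalHom]

include h in
theorem toPierce_injective :
    Function.Injective (toPierce : (A →ₐ[k] L) → PierceSpec (L ⊗[k] A)) := fun f g hfg => by
  rw [← pointHom_toPierce h f, hfg, pointHom_toPierce]

theorem continuous_pointHom : Continuous (pointHom h) := by
  refine continuous_generateFrom_iff.2 ?_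
  rintro _ ⟨a, b, rfl⟩
  exact isOpen_evalHom_eq h (1 ⊗ₜ a) b

/-- `Hom_k(A, L) ≃ S(L ⊗_k A)` for split `A`. -/
def homPierce : (A →ₐ[k] L) ≃ₜ PierceSpec (L ⊗[k] A) where
  toFun := toPierce
  invFun := pointHom h
  left_inv := pointHom_toPierce h
  right_inv := toPierce_pointHom h
  continuous_toFun := continuous_toPierce
  continuous_invFun := continuous_pointHom h

end Points

/-! ### The difference operators on `Hom_k(A, L)` and `Gal(L/k)` -/

section Sigma

variable {k L : Type u} [Field k] [Field L] [Algebra k L] {σk : k →+* k} {σL : L →+* L}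
  (hσ : ∀ c : k, σL (algebraMap k L c) = algebraMap k L (σk c))

section Hom

variable {A : DiffAlg k σk} (h : IdemSpanned L (L ⊗[k] A))

/-- The difference operator `()^σ` of `Hom_k(A, L)`, transported from `S(L ⊗_k A)`. -/
def homσ (f : A →ₐ[k] L) : A →ₐ[k] L :=
  pointHom h (PierceSpec.map (tensorσ (extension hσ) A) (toPierce f))

theorem continuous_homσ : Continuous (homσ hσ h) :=
  (continuous_pointHom h).comp ((PierceSpec.continuous_map _).comp continuous_toPierce)

theorem toPierce_homσ (f : A →ₐ[k] L) :
    toPierce (homσ hσ h f) = PierceSpec.map (tensorσ (extension hσ) A) (toPierce f) :=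
  toPierce_pointHom h _

theorem apply_σ (f : A →ₐ[k] L) (a : A) : f (A.σ a) = σL (homσ hσ h f a) := by
  have h1 := evalHom_map h h σL (tensorσ (extension hσ) A) (tensorσ_smul hσ A) (toPierce f)
    (1 ⊗ₜ[k] a : L ⊗[k] A)
  rw [tensorσ_tmul, map_one] at h1
  rw [homσ, pointHom_apply, ← h1, ← pointHom_apply, pointHom_toPierce]

theorem homσ_unique {f f' : A →ₐ[k] L} (hf : ∀ a, f (A.σ a) = σL (f' a)) : homσ hσ h f = f' :=
  AlgHom.ext fun a => σL.injective (by rw [← apply_σ, hf])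

theorem homσ_pointHom (x : PierceSpec (L ⊗[k] A)) :
    homσ hσ h (pointHom h x) = pointHom h (PierceSpec.map (tensorσ (extension hσ) A) x) := by
  rw [homσ, toPierce_pointHom]

/-- `⟦A, L⟧_k ≃ Hom_k(A, L)`: a sequence is determined by its zeroth term `f`, its terms being
`f, f^σ, f^σσ, …`. -/
def intHomHomeo : IntHom A (extension hσ) ≃ₜ (A →ₐ[k] L) where
  toFun f := f.comp 0
  invFun f := ⟨fun n => (homσ hσ h)^[n] f, fun i a => by
    have h1 := apply_σ hσ h ((homσ hσ h)^[i] f) a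
    rwa [← Function.iterate_succ_apply' (homσ hσ h)] at h1⟩
  left_inv f := by
    refine Subtype.ext (funext fun n => ?_)
    change (homσ hσ h)^[n] (f.1 0) = f.1 n
    induction n with
    | zero => rfl
    | succ n ih =>
      rw [Function.iterate_succ_apply', ih]
      exact homσ_unique hσ h (f.2 n)
  right_inv f := rfl
  continuous_toFun := continuous_generateFrom_iff.2 (by
    rintro _ ⟨a, b, rfl⟩
    exact TopologicalSpace.isOpen_generateFrom_of_mem ⟨a, b, 0, rfl⟩)
  continuous_invFun := continuous_generateFrom_iff.2 (by
    rintro _ ⟨a, b, n, rfl⟩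
    have hopen : IsOpen {f : A →ₐ[k] L | f a = b} :=
      TopologicalSpace.isOpen_generateFrom_of_mem ⟨a, b, rfl⟩
    exact hopen.preimage ((continuous_homσ hσ h).iterate n))

theorem shift_comp_zero (f : IntHom A (extension hσ)) :
    f.shift.comp 0 = homσ hσ h (f.comp 0) :=
  (homσ_unique hσ h (f.2 0)).symm

end Hom

section Gal

variable [IsGalois k L]

theorem idemSpanned_self : IdemSpanned L (L ⊗[k] L) := isSplitElem_self.idemSpanned

/-- `Gal(L/k) ≃ Hom_k(L, L)`: the Krull topology is the topology of pointwise convergence. -/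
def galHomHomeo : (L ≃ₐ[k] L) ≃ₜ (L →ₐ[k] L) :=
  have : T2Space (L →ₐ[k] L) := (homPierce idemSpanned_self).symm.t2Space
  Continuous.homeoOfEquivCompactToT2 (f := (Algebra.IsAlgebraic.algEquivEquivAlgHom k L).toEquiv)
    (continuous_generateFrom_iff.2 (by
      rintro _ ⟨a, b, rfl⟩
      refine isOpen_iff_mem_nhds.2 fun g (hg : g a = b) => ?_
      have hopen := (stabilizer_isOpen_of_isIntegral (K := k) a).preimage
        (continuous_const_mul g⁻¹)
      refine Filter.mem_of_superset (hopen.mem_nhds ?_) fun g' hg' => ?_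
      · simp
      · have h1 : (g⁻¹ * g') a = a := hg'
        have h2 : g' a = g ((g⁻¹ * g') a) := by
          rw [← AlgEquiv.mul_apply, mul_inv_cancel_left]
        change g' a = b
        rw [h2, h1, hg]))

@[simp]
theorem coe_galHomHomeo_symm (f : L →ₐ[k] L) :
    ((galHomHomeo.symm f : L ≃ₐ[k] L) : L →ₐ[k] L) = f :=
  galHomHomeo.apply_symm_apply f

/-- The endomorphism `()^σ` of `Gal(L/k)`, characterised by `g ∘ σ_L = σ_L ∘ g^σ`. -/
def galτ : (L ≃ₐ[k] L) →* (L ≃ₐ[k] L) :=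
  have key : ∀ (g : L ≃ₐ[k] L) (x : L), g (σL x) =
      σL (galHomHomeo.symm (homσ hσ (A := extension hσ) idemSpanned_self (g : L →ₐ[k] L)) x) :=
    fun g x => by
      refine (apply_σ hσ (A := extension hσ) idemSpanned_self (g : L →ₐ[k] L) x).trans ?_
      exact congrArg σL (DFunLike.congr_fun (coe_galHomHomeo_symm
        (homσ hσ (A := extension hσ) idemSpanned_self (g : L →ₐ[k] L))) x).symm
  { toFun := fun g =>
      galHomHomeo.symm (homσ hσ (A := extension hσ) idemSpanned_self (g : L →ₐ[k] L))
    map_one' := AlgEquiv.ext fun x => σL.injective ((key 1 x).symm)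
    map_mul' := fun g g' => AlgEquiv.ext fun x => σL.injective (by
      rw [← key (g * g') x, AlgEquiv.mul_apply, AlgEquiv.mul_apply, key g', key g]) }

theorem coe_galτ (g : L ≃ₐ[k] L) : (galτ hσ g : L →ₐ[k] L) =
    homσ hσ (A := extension hσ) idemSpanned_self (g : L →ₐ[k] L) :=
  coe_galHomHomeo_symm _

theorem galτ_spec (g : L ≃ₐ[k] L) (x : L) : g (σL x) = σL (galτ hσ g x) := by
  refine (apply_σ hσ (A := extension hσ) idemSpanned_self (g : L →ₐ[k] L) x).trans ?_
  exact congrArg σL (DFunLike.congr_fun (coe_galτ hσ g) x).symm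

theorem galτ_unique {g g' : L ≃ₐ[k] L} (hg : ∀ x, g (σL x) = σL (g' x)) : galτ hσ g = g' :=
  AlgEquiv.ext fun x => σL.injective (by rw [← galτ_spec, hg])

theorem continuous_galτ : Continuous (galτ hσ) :=
  galHomHomeo.symm.continuous.comp ((continuous_homσ hσ (A := extension hσ) idemSpanned_self).comp
    galHomHomeo.continuous)

/-- `()^σ` on `Hom_k(A, L)` is compatible with `()^σ` on `Gal(L/k)`. -/
theorem homσ_comp {A : DiffAlg k σk} (h : IdemSpanned L (L ⊗[k] A)) (g : L ≃ₐ[k] L)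
    (f : A →ₐ[k] L) :
    homσ hσ h ((g : L →ₐ[k] L).comp f) = (galτ hσ g : L →ₐ[k] L).comp (homσ hσ h f) :=
  homσ_unique hσ h fun a => by
    change g (f (A.σ a)) = σL (galτ hσ g (homσ hσ h f a))
    rw [apply_σ hσ h, galτ_spec hσ]

/-- `Aut⟦L⟧_k ≃ Gal(L/k)`, sending a sequence to its zeroth term. -/
def intAutEquiv : IntAut (extension hσ) ≃ₜ* (L ≃ₐ[k] L) where
  toFun f := f.comp 0
  invFun g := ⟨fun n => (galτ hσ)^[n] g, fun i a => by
    have h1 := galτ_spec hσ ((galτ hσ)^[i] g) a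
    rwa [← Function.iterate_succ_apply' (galτ hσ)] at h1⟩
  left_inv f := by
    refine Subtype.ext (funext fun n => ?_)
    change (galτ hσ)^[n] (f.1 0) = f.1 n
    induction n with
    | zero => rfl
    | succ n ih =>
      rw [Function.iterate_succ_apply', ih]
      exact galτ_unique hσ (f.2 n)
  right_inv g := rfl
  map_mul' f g := rfl
  continuous_toFun :=
    galHomHomeo.symm.continuous.comp ((intHomHomeo hσ (A := extension hσ)
      idemSpanned_self).continuous.comp continuous_induced_dom) |>.congr fun f =>
        galHomHomeo.symm_apply_apply (f.comp 0)
  continuous_invFun := continuous_induced_rng.2 <|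
    ((intHomHomeo hσ (A := extension hσ) idemSpanned_self).symm.continuous.comp
      galHomHomeo.continuous).congr fun g =>
        (intHomHomeo hσ (A := extension hσ) idemSpanned_self).injective rfl

theorem intAutEquiv_shift (f : IntAut (extension hσ)) :
    intAutEquiv hσ f.shift = galτ hσ (intAutEquiv hσ f) :=
  (galτ_unique hσ (f.2 0)).symm

end Gal

end Sigma

/-! ### The categorical Galois group -/

section Groupoid

variable {k L : Type u} [Field k] [Field L] [Algebra k L] {σk : k →+* k} {σL : L →+* L}
  (hσ : ∀ c : k, σL (algebraMap k L c) = algebraMap k L (σk c))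

section Composable

variable {A : DiffAlg k σk}

/-- The point `a ⊗ b ⊗ c ↦ a g(b) g(f(c))` of `S(L ⊗_k (L ⊗_k A))`: the composable pair of
`g` and `f`. -/
def compPoint (g : L ≃ₐ[k] L) (f : A →ₐ[k] L) : PierceSpec (L ⊗[k] (L ⊗[k] A)) :=
  toPierce (Algebra.TensorProduct.productMap (g : L →ₐ[k] L) ((g : L →ₐ[k] L).comp f))

theorem pr₁₂_compPoint (g : L ≃ₐ[k] L) (f : A →ₐ[k] L) :
    pr₁₂ (extension hσ) A (compPoint g f) = toPierce (g : L →ₐ[k] L) := by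
  refine (map_toPierce _ _).trans (congrArg toPierce ?_)
  exact Algebra.TensorProduct.productMap_left _ _

theorem pr₁₃_compPoint (g : L ≃ₐ[k] L) (f : A →ₐ[k] L) :
    pr₁₃ (extension hσ) A (compPoint g f) = toPierce ((g : L →ₐ[k] L).comp f) := by
  refine (map_toPierce _ _).trans (congrArg toPierce ?_)
  exact Algebra.TensorProduct.productMap_right _ _

theorem pr₂₃_compPoint (g : L ≃ₐ[k] L) (f : A →ₐ[k] L) :
    pr₂₃ (extension hσ) A (compPoint g f) = toPierce f := by
  refine (PierceSpec.map_ofHom _ _).trans (Eq.trans (congrArg PierceSpec.ofHom ?_)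
    (PierceSpec.ofHom_comp (Algebra.TensorProduct.productMap (AlgHom.id k L) f).toRingHom
      (g : L →+* L)))
  have h1 : (Algebra.TensorProduct.productMap (AlgHom.id k L) (Algebra.TensorProduct.productMap
      (g : L →ₐ[k] L) ((g : L →ₐ[k] L).comp f))).comp Algebra.TensorProduct.includeRight =
      (g : L →ₐ[k] L).comp (Algebra.TensorProduct.productMap (AlgHom.id k L) f) := by
    ext <;> simp
  exact RingHom.ext fun z => DFunLike.congr_fun h1 z

variable [IsGalois k L] (h : IdemSpanned L (L ⊗[k] A))

include h in
theorem idemSpanned_tensor_tensor : IdemSpanned L (L ⊗[k] (L ⊗[k] A)) := by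
  rw [IdemSpanned, eq_top_iff]
  intro z _
  induction z using TensorProduct.induction_on with
  | zero => exact Subalgebra.zero_mem _
  | add x y hx hy => exact Subalgebra.add_mem _ (hx trivial) (hy trivial)
  | tmul l w =>
    induction w using TensorProduct.induction_on with
    | zero =>
      rw [TensorProduct.tmul_zero]
      exact Subalgebra.zero_mem _
    | add x y hx hy =>
      rw [TensorProduct.tmul_add]
      exact Subalgebra.add_mem _ (hx trivial) (hy trivial)
    | tmul m a =>
      have h1 : l ⊗ₜ[k] (m ⊗ₜ[k] a) =
          Algebra.TensorProduct.map (AlgHom.id L L)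
            (Algebra.TensorProduct.includeLeft : L →ₐ[k] L ⊗[k] A) (l ⊗ₜ[k] m) *
          Algebra.TensorProduct.map (AlgHom.id L L)
            (Algebra.TensorProduct.includeRight : A →ₐ[k] L ⊗[k] A) (1 ⊗ₜ[k] a) := by
        simp
      rw [h1]
      exact Subalgebra.mul_mem _ (idemSpanned_self.apply_mem_adjoin _ _)
        (h.apply_mem_adjoin _ _)

include h in
theorem exists_eq_compPoint (w : PierceSpec (L ⊗[k] (L ⊗[k] A))) :
    ∃ (g : L ≃ₐ[k] L) (f : A →ₐ[k] L), w = compPoint g f := by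
  let F := pointHom (idemSpanned_tensor_tensor h) w
  let g : L ≃ₐ[k] L :=
    galHomHomeo.symm (F.comp (Algebra.TensorProduct.includeLeft : L →ₐ[k] L ⊗[k] A))
  refine ⟨g, (g.symm : L →ₐ[k] L).comp
    (F.comp (Algebra.TensorProduct.includeRight : A →ₐ[k] L ⊗[k] A)), ?_⟩
  rw [← toPierce_pointHom (idemSpanned_tensor_tensor h) w]
  refine congrArg toPierce ?_
  change F = _
  have hg : (g : L →ₐ[k] L) = F.comp Algebra.TensorProduct.includeLeft := coe_galHomHomeo_symm _
  refine Algebra.TensorProduct.ext ?_ ?_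
  · rw [Algebra.TensorProduct.productMap_left, hg]
  · ext a
    simp

include h in
/-- `S` preserves the fibre product of composable pairs. -/
theorem isHomeomorph_pr₁₂_pr₂₃ : IsHomeomorph fun w : PierceSpec (L ⊗[k] (L ⊗[k] A)) =>
    (pr₁₂ (extension hσ) A w, pr₂₃ (extension hσ) A w) := by
  refine isHomeomorph_iff_continuous_bijective.2
    ⟨(PierceSpec.continuous_map _).prodMk (PierceSpec.continuous_map _), ?_, ?_⟩
  · intro w w' hw
    obtain ⟨g, f, rfl⟩ := exists_eq_compPoint h w
    obtain ⟨g', f', rfl⟩ := exists_eq_compPoint h w'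
    have h1 := (pr₁₂_compPoint hσ g f).symm.trans
      ((congrArg Prod.fst hw).trans (pr₁₂_compPoint hσ g' f'))
    have h2 := (pr₂₃_compPoint hσ g f).symm.trans
      ((congrArg Prod.snd hw).trans (pr₂₃_compPoint hσ g' f'))
    rw [toPierce_injective h h2,
      galHomHomeo.injective (toPierce_injective idemSpanned_self h1)]
  · rintro ⟨x, y⟩
    refine ⟨compPoint (galHomHomeo.symm (pointHom idemSpanned_self x)) (pointHom h y), ?_⟩
    refine Prod.ext ((pr₁₂_compPoint hσ _ _).trans ?_)
      ((pr₂₃_compPoint hσ _ _).trans (toPierce_pointHom h y))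
    rw [coe_galHomHomeo_symm]
    exact toPierce_pointHom idemSpanned_self x

end Composable

variable [IsGalois k L]

/-- `Gal[f] = S(L ⊗_k L) ≃ Gal(L/k)` as spaces. -/
def galSpaceHomeo : GalSpace (extension hσ) ≃ₜ (L ≃ₐ[k] L) :=
  (homPierce idemSpanned_self).symm.trans galHomHomeo.symm

theorem galSpaceHomeo_symm_apply (g : L ≃ₐ[k] L) :
    (galSpaceHomeo hσ).symm g = toPierce (g : L →ₐ[k] L) := rfl

/-- The group structure of `Gal[f]`, transported from `Gal(L/k)`. -/
abbrev galSpaceGroup : Group (GalSpace (extension hσ)) := (galSpaceHomeo hσ).toEquiv.group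

/-- `Gal[f] ≃ Gal(L/k)` as topological groups. -/
def galSpaceEquiv :
    letI := galSpaceGroup hσ
    GalSpace (extension hσ) ≃ₜ* (L ≃ₐ[k] L) :=
  letI := galSpaceGroup hσ
  { galSpaceHomeo hσ with
    map_mul' := (galSpaceHomeo hσ).toEquiv.mulEquiv.map_mul }

theorem galSpaceHomeo_galσ (x : GalSpace (extension hσ)) :
    galSpaceHomeo hσ (galσ (extension hσ) x) = galτ hσ (galSpaceHomeo hσ x) := by
  obtain ⟨g, rfl⟩ := (galSpaceHomeo hσ).symm.surjective x
  rw [Homeomorph.apply_symm_apply, ← Homeomorph.eq_symm_apply, galSpaceHomeo_symm_apply,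
    galSpaceHomeo_symm_apply, coe_galτ]
  exact (toPierce_homσ hσ (A := extension hσ) idemSpanned_self _).symm

theorem galSpaceHomeo_apply_σ (g : GalSpace (extension hσ)) (x : L) :
    galSpaceHomeo hσ g (σL x) = σL (galSpaceHomeo hσ (galσ (extension hσ) g) x) :=
  (galτ_spec hσ (galSpaceHomeo hσ g) x).trans
    (congrArg (fun γ : L ≃ₐ[k] L => σL (γ x)) (galSpaceHomeo_galσ hσ g).symm)

theorem isCategoricalGaloisGroup :
    letI := galSpaceGroup hσ
    IsCategoricalGaloisGroup (extension hσ) := by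
  let := galSpaceGroup hσ
  have hmul : ∀ g g' : L ≃ₐ[k] L, (toPierce (g : L →ₐ[k] L) : GalSpace (extension hσ)) *
      (toPierce (g' : L →ₐ[k] L) : GalSpace (extension hσ)) =
        toPierce ((g * g' : L ≃ₐ[k] L) : L →ₐ[k] L) := fun g g' =>
    ((galSpaceEquiv hσ).symm.map_mul g g').symm
  refine ⟨⟨PierceSpec.uniqueOfField (F := L)⟩,
    isHomeomorph_pr₁₂_pr₂₃ hσ (A := extension hσ) idemSpanned_self, fun w => ?_, fun x => ?_,
    fun x => ?_, ?_, fun x y => ?_⟩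
  · obtain ⟨g, f, rfl⟩ := exists_eq_compPoint (A := extension hσ) idemSpanned_self w
    obtain ⟨g', rfl⟩ := galHomHomeo.surjective f
    rw [pr₁₂_compPoint, pr₂₃_compPoint, pr₁₃_compPoint]
    exact hmul g g'
  · have hx : x = PierceSpec.ofHom (RingHom.id L) :=
      Subsingleton.elim (α := PierceSpec L) _ _
    refine Eq.trans (b := toPierce ((1 : L ≃ₐ[k] L) : L →ₐ[k] L))
      (galSpaceEquiv hσ).symm.map_one.symm ?_
    rw [hx]
    refine Eq.trans (congrArg PierceSpec.ofHom ?_) (PierceSpec.map_ofHom _ _).symm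
    have : Algebra.TensorProduct.productMap (AlgHom.id k L) ((1 : L ≃ₐ[k] L) : L →ₐ[k] L) =
        Algebra.TensorProduct.lmul' k := by ext <;> simp
    rw [this]
    rfl
  · obtain ⟨g, rfl⟩ := (galSpaceHomeo hσ).symm.surjective x
    refine Eq.trans (b := toPierce ((g⁻¹ : L ≃ₐ[k] L) : L →ₐ[k] L))
      ((galSpaceEquiv hσ).symm.map_inv g).symm ?_
    -- `g (a * g⁻¹ b) = b * g a`, and composing with `g` keeps the idempotents sent to `1`.
    refine Eq.trans ?_ (PierceSpec.map_ofHom _ _).symm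
    refine (PierceSpec.ofHom_comp _ (g : L →+* L)).symm.trans (congrArg PierceSpec.ofHom ?_)
    have h1 : (g : L →ₐ[k] L).comp (Algebra.TensorProduct.productMap (AlgHom.id k L)
        ((g⁻¹ : L ≃ₐ[k] L) : L →ₐ[k] L)) =
        (Algebra.TensorProduct.productMap (AlgHom.id k L) (g : L →ₐ[k] L)).comp
          (Algebra.TensorProduct.comm k L L).toAlgHom := by
      ext a
      · simp
      · simp
    exact RingHom.ext fun z => DFunLike.congr_fun h1 z
  · exact { continuous_mul := by
              refine ((galSpaceEquiv hσ).symm.continuous.comp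
                (((galSpaceEquiv hσ).continuous.comp continuous_fst).mul
                  ((galSpaceEquiv hσ).continuous.comp continuous_snd))).congr fun p => ?_
              exact ((galSpaceEquiv hσ).symm_apply_eq).2 ((galSpaceEquiv hσ).map_mul _ _).symm
            continuous_inv := by
              refine ((galSpaceEquiv hσ).symm.continuous.comp
                (galSpaceEquiv hσ).continuous.inv).congr fun p => ?_
              exact ((galSpaceEquiv hσ).symm_apply_eq).2 (map_inv (galSpaceEquiv hσ) _).symm }
  · refine (galSpaceEquiv hσ).injective ?_
    rw [map_mul]
    refine (galSpaceHomeo_galσ hσ _).trans ?_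
    refine (congrArg (galτ hσ) ((galSpaceEquiv hσ).map_mul x y)).trans ?_
    rw [map_mul]
    exact (congrArg₂ (· * ·) (galSpaceHomeo_galσ hσ x) (galSpaceHomeo_galσ hσ y)).symm

end Groupoid

/-! ### Equivariant locally constant functions -/

section Equivariant

open Topology

variable {k L : Type u} [Field k] [Field L] [Algebra k L]

/-- Dedekind's independence of the embeddings `E → L`, for a normal subextension `E`. -/
theorem exists_sum_mul_ne_zero (E : IntermediateField k L) [FiniteDimensional k E]
    (n : (E ≃ₐ[k] E) → L) (hn : n 1 ≠ 0) : ∃ c : E, ∑ γ, n γ * (γ c : E) ≠ 0 := by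
  by_contra! H
  let v : (E ≃ₐ[k] E) → (E →* L) := fun γ => (algebraMap E L : E →* L).comp (γ : E →* E)
  have hv : Function.Injective v := fun γ γ' h =>
    AlgEquiv.ext fun c => Subtype.ext (DFunLike.congr_fun h c)
  have hind := (linearIndependent_monoidHom E L).comp v hv
  refine hn (Fintype.linearIndependent_iff.1 hind n (funext fun c => ?_) 1)
  exact (Finset.sum_apply _ _ _).trans (H c)

variable {X : Type u} [TopologicalSpace X] [MulAction (L ≃ₐ[k] L) X]
  [ContinuousSMul (L ≃ₐ[k] L) X] {U : Set X}

/-- By compactness, a clopen set is stable under an open normal subgroup. -/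
theorem exists_fixingSubgroup_stabilizes [Normal k L] [CompactSpace X] (hU : IsClopen U) :
    ∃ E : IntermediateField k L, FiniteDimensional k E ∧ Normal k E ∧
      ∀ g ∈ E.fixingSubgroup, ∀ x : X, g • x ∈ U ↔ x ∈ U := by
  have hev : ∀ᶠ g : L ≃ₐ[k] L in 𝓝 1, ∀ x ∈ (Set.univ : Set X), g • x ∈ U ↔ x ∈ U := by
    refine isCompact_univ.eventually_forall_of_forall_eventually fun x _ => ?_
    have hc : ContinuousAt (fun p : (L ≃ₐ[k] L) × X => p.1 • p.2) (1, x) :=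
      continuous_smul.continuousAt
    have hc' : ContinuousAt (fun p : (L ≃ₐ[k] L) × X => p.2) (1, x) := continuousAt_snd
    by_cases hx : x ∈ U
    · filter_upwards [hc.eventually_mem (hU.2.mem_nhds (by simpa using hx)),
        hc'.eventually_mem (hU.2.mem_nhds hx)] with p h1 h2
      exact iff_of_true h1 h2
    · filter_upwards [hc.eventually_mem (hU.compl.2.mem_nhds (by simpa using hx)),
        hc'.eventually_mem (hU.compl.2.mem_nhds hx)] with p h1 h2
      exact iff_of_false h1 h2
  obtain ⟨E, hfin, hnorm, hE⟩ := (krullTopology_mem_nhds_one_iff_of_normal k L _).1 hev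
  exact ⟨E, hfin, hnorm, fun g hg x => hE hg x trivial⟩

variable (E : IntermediateField k L) [Normal k E] [Normal k L]

/-- A lift of an automorphism of `E` to `L`. -/
def liftAut (γ : E ≃ₐ[k] E) : L ≃ₐ[k] L :=
  (AlgEquiv.restrictNormalHom_surjective (F := k) (K₁ := E) L γ).choose

theorem restrictNormalHom_liftAut (γ : E ≃ₐ[k] E) :
    AlgEquiv.restrictNormalHom E (liftAut E γ) = γ :=
  (AlgEquiv.restrictNormalHom_surjective (F := k) (K₁ := E) L γ).choose_spec

omit [TopologicalSpace X] [ContinuousSMul (L ≃ₐ[k] L) X] [Normal k L] in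
theorem inv_smul_mem_iff (hEU : ∀ g ∈ E.fixingSubgroup, ∀ x : X, g • x ∈ U ↔ x ∈ U)
    {g g' : L ≃ₐ[k] L}
    (h : AlgEquiv.restrictNormalHom E g = AlgEquiv.restrictNormalHom E g') (x : X) :
    g⁻¹ • x ∈ U ↔ g'⁻¹ • x ∈ U := by
  have hmem : g'⁻¹ * g ∈ E.fixingSubgroup := by
    rw [← IntermediateField.restrictNormalHom_ker, MonoidHom.mem_ker, map_mul, map_inv, h,
      inv_mul_cancel]
  rw [← hEU _ hmem (g⁻¹ • x), smul_smul, mul_assoc, mul_inv_cancel, mul_one]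

variable [FiniteDimensional k E]

/-- The trace of the function `c · 1_U` over `Gal(E/k)`, for `c ∈ E`; it takes `x` to the sum of the
`γ(c)` with `γ⁻¹ x ∈ U`.  When `U` is stable under `Gal(L/E)`, the condition does not depend on the
lift of `γ` to `L` (`inv_smul_mem_iff`). -/
def traceFun (hU : IsClopen U) (c : E) : LocallyConstant X L :=
  ∑ γ : E ≃ₐ[k] E, ((γ c : E) : L) • LocallyConstant.charFn L
    (hU.preimage (continuous_const_smul (liftAut E γ)⁻¹))

open Classical in
theorem traceFun_apply (hU : IsClopen U) (c : E) (x : X) :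
    traceFun E hU c x =
      ∑ γ : E ≃ₐ[k] E, (if (liftAut E γ)⁻¹ • x ∈ U then 1 else 0) * ((γ c : E) : L) := by
  change LocallyConstant.evalRingHom x (traceFun E hU c) = _
  rw [traceFun, map_sum]
  refine Finset.sum_congr rfl fun γ _ => ?_
  rw [mul_comm]
  change ((γ c : E) : L) * LocallyConstant.charFn L _ x = _
  rw [LocallyConstant.coe_charFn]
  rfl

theorem traceFun_smul (hEU : ∀ g ∈ E.fixingSubgroup, ∀ x : X, g • x ∈ U ↔ x ∈ U)
    (hU : IsClopen U) (c : E) (g : L ≃ₐ[k] L) (x : X) :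
    traceFun E hU c (g • x) = g (traceFun E hU c x) := by
  classical
  rw [traceFun_apply, traceFun_apply, map_sum]
  refine (Fintype.sum_equiv (Equiv.mulLeft (AlgEquiv.restrictNormalHom E g)) _ _
    fun γ => ?_).symm
  have h1 := inv_smul_mem_iff E hEU (g := liftAut E (AlgEquiv.restrictNormalHom E g * γ))
    (g' := g * liftAut E γ)
    (by rw [restrictNormalHom_liftAut, map_mul, restrictNormalHom_liftAut]) (g • x)
  rw [mul_inv_rev, mul_smul _ g⁻¹, inv_smul_smul] at h1
  simp only [Equiv.coe_mulLeft, h1, AlgEquiv.mul_apply, map_mul,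
    AlgEquiv.restrictNormalHom_apply]
  split_ifs <;> simp

omit [Normal k E] [FiniteDimensional k E] in
/-- Equivariant functions `X → L` separate a point from a point outside a clopen set, and from
the points whose orbit does not meet it. -/
theorem exists_equivariant_ne [CompactSpace X] (hU : IsClopen U) {x : X} (hx : x ∈ U) :
    (∀ y ∉ U, ∃ h : LocallyConstant X L,
      (∀ (g : L ≃ₐ[k] L) z, h (g • z) = g (h z)) ∧ h x ≠ h y) ∧
    ∃ h : LocallyConstant X L, (∀ (g : L ≃ₐ[k] L) z, h (g • z) = g (h z)) ∧ h x ≠ 0 ∧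
      ∀ y, (∀ g : L ≃ₐ[k] L, g • y ∉ U) → h y = 0 := by
  classical
  obtain ⟨E, _, _, hEU⟩ := exists_fixingSubgroup_stabilizes (k := k) (L := L) hU
  have h1 : ∀ y : X, (liftAut E (1 : E ≃ₐ[k] E))⁻¹ • y ∈ U ↔ y ∈ U := fun y => by
    have := inv_smul_mem_iff E hEU (g := liftAut E (1 : E ≃ₐ[k] E)) (g' := (1 : L ≃ₐ[k] L))
      ((restrictNormalHom_liftAut E 1).trans (map_one _).symm) y
    rwa [inv_one, one_smul] at this
  constructor
  · intro y hy
    obtain ⟨c, hc⟩ := exists_sum_mul_ne_zero E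
      (fun γ => (if (liftAut E γ)⁻¹ • x ∈ U then 1 else 0) -
        (if (liftAut E γ)⁻¹ • y ∈ U then 1 else 0)) (by simp [h1, hx, hy])
    refine ⟨traceFun E hU c, traceFun_smul E hEU hU c, fun h => hc ?_⟩
    rw [traceFun_apply, traceFun_apply] at h
    simp only [sub_mul, Finset.sum_sub_distrib]
    exact sub_eq_zero.2 h
  · obtain ⟨c, hc⟩ := exists_sum_mul_ne_zero E
      (fun γ => if (liftAut E γ)⁻¹ • x ∈ U then 1 else 0) (by simp [h1, hx])
    refine ⟨traceFun E hU c, traceFun_smul E hEU hU c, fun h => hc ?_, fun y hy => ?_⟩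
    · rwa [traceFun_apply] at h
    · rw [traceFun_apply]
      exact Finset.sum_eq_zero fun γ _ => by rw [if_neg (hy _), zero_mul]

end Equivariant

/-! ### Galois descent for `L ⊗_k A` -/

section Descent

variable {k L : Type u} [Field k] [Field L] [Algebra k L] {A : Type u} [CommRing A] [Algebra k A]

/-- The invariants of `L ⊗_k A` under `Gal(L/k)`, acting on `L`, are `A`: compare coordinates in a
basis of `A` over `k`. -/
theorem exists_eq_one_tmul [IsGalois k L] (z : L ⊗[k] A)
    (hz : ∀ g : L ≃ₐ[k] L,
      Algebra.TensorProduct.map (g : L →ₐ[k] L) (AlgHom.id k A) z = z) :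
    ∃ a : A, z = 1 ⊗ₜ a := by
  let b := Module.Basis.ofVectorSpace k A
  let B := Algebra.TensorProduct.basis L b
  have hrepr : ∀ (g : L ≃ₐ[k] L) (w : L ⊗[k] A) i,
      B.repr (Algebra.TensorProduct.map (g : L →ₐ[k] L) (AlgHom.id k A) w) i =
        g (B.repr w i) := fun g w i => by
    induction w using TensorProduct.induction_on with
    | zero => simp
    | add x y hx hy => simp only [map_add, Finsupp.add_apply, hx, hy]
    | tmul l a =>
      simp [B, Algebra.TensorProduct.basis_repr_tmul]
  have hmem : z ∈ (Algebra.TensorProduct.includeRight : A →ₐ[k] L ⊗[k] A).range := by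
    rw [← B.linearCombination_repr z, Finsupp.linearCombination_apply]
    refine Subalgebra.sum_mem _ fun i _ => ?_
    obtain ⟨c, hc⟩ := (InfiniteGalois.mem_range_algebraMap_iff_fixed (k := k) (B.repr z i)).2
      fun g => by rw [← hrepr, hz]
    refine ⟨c • b i, ?_⟩
    change 1 ⊗ₜ (c • b i) = B.repr z i • B i
    rw [Algebra.TensorProduct.basis_apply, ← hc, TensorProduct.tmul_smul, algebraMap_smul]
  obtain ⟨a, ha⟩ := hmem
  exact ⟨a, ha.symm⟩

end Descent

/-! ### The functors between split algebras and profinite spaces with action -/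

namespace DiffProfAct

variable {G : Type u} [Group G] [TopologicalSpace G] {σG : G → G}

/-- A bijective morphism of profinite spaces with action is an isomorphism. -/
def isoOfBijective {X Y : DiffProfAct G σG} (f : X ⟶ Y)
    (hf : Function.Bijective (Hom.toHom f).toMap) : X ≅ Y :=
  let e : X.toDiffProf ≃ₜ Y.toDiffProf := Continuous.homeoOfEquivCompactToT2
    (f := Equiv.ofBijective (Hom.toHom f).toMap hf) (Hom.toHom f).toMap.continuous
  have he : ∀ y, (Hom.toHom f).toMap (e.symm y) = y := e.apply_symm_apply
  { hom := f
    inv :=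
      { toHom :=
          { toMap := ⟨e.symm, e.symm.continuous⟩
            comm := fun y => hf.1 (by
              change (Hom.toHom f).toMap (e.symm _) = (Hom.toHom f).toMap (X.σ (e.symm y))
              rw [he, (Hom.toHom f).comm, he]) }
        smul := fun g y => hf.1 (by
          change (Hom.toHom f).toMap (e.symm _) = (Hom.toHom f).toMap (g • e.symm y)
          rw [he, Hom.smul f, he]) }
    hom_inv_id := Hom.ext (DiffProf.Hom.ext (ContinuousMap.ext e.symm_apply_apply))
    inv_hom_id := Hom.ext (DiffProf.Hom.ext (ContinuousMap.ext e.apply_symm_apply)) }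

end DiffProfAct

section Functors

variable {k L : Type u} [Field k] [Field L] [Algebra k L]

theorem continuous_galComp [IsGalois k L] {A : Type u} [CommRing A] [Algebra k A] :
    Continuous fun p : (L ≃ₐ[k] L) × (A →ₐ[k] L) => (p.1 : L →ₐ[k] L).comp p.2 := by
  refine continuous_generateFrom_iff.2 ?_
  rintro _ ⟨a, b, rfl⟩
  refine isOpen_iff_mem_nhds.2 fun p hp => ?_
  have h1 : IsOpen {g : L ≃ₐ[k] L | g (p.2 a) = b} := by
    have : IsOpen {f : L →ₐ[k] L | f (p.2 a) = b} :=
      TopologicalSpace.isOpen_generateFrom_of_mem ⟨_, _, rfl⟩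
    exact this.preimage galHomHomeo.continuous
  have h2 : IsOpen {f : A →ₐ[k] L | f a = p.2 a} :=
    TopologicalSpace.isOpen_generateFrom_of_mem ⟨_, _, rfl⟩
  refine Filter.mem_of_superset (prod_mem_nhds (h1.mem_nhds hp) (h2.mem_nhds rfl)) ?_
  rintro ⟨g, f⟩ ⟨hg, hf⟩
  exact (congrArg g hf).trans hg

/-- Naturality in `A` of `S(L ⊗_k A) ≃ Hom_k(A, L)`. -/
theorem pointHom_map {A B : Type u} [CommRing A] [Algebra k A] [CommRing B] [Algebra k B]
    (hA : IdemSpanned L (L ⊗[k] A)) (hB : IdemSpanned L (L ⊗[k] B)) (φ : A →ₐ[k] B)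
    (x : PierceSpec (L ⊗[k] B)) :
    pointHom hA (PierceSpec.map (Algebra.TensorProduct.map (AlgHom.id k L) φ).toRingHom x) =
      (pointHom hB x).comp φ := by
  refine toPierce_injective hA ?_
  rw [toPierce_pointHom, ← map_toPierce, toPierce_pointHom]

variable [IsGalois k L] {σk : k →+* k} {σL : L →+* L}
  (hσ : ∀ c : k, σL (algebraMap k L c) = algebraMap k L (σk c))
  {G : Type u} [Group G] [TopologicalSpace G] {σG : G → G} (ρ : G ≃ₜ* (L ≃ₐ[k] L))
  (hρ : ∀ (g : G) (x : L),
    (ρ : G →* (L ≃ₐ[k] L)) g (σL x) = σL ((ρ : G →* (L ≃ₐ[k] L)) (σG g) x))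

include hρ in
theorem galτ_apply (g : G) : galτ hσ (ρ g) = ρ (σG g) := galτ_unique hσ (hρ g)

/-- `S(L ⊗_k A)` with the action of `G ≃ Gal(L/k)` which on `Hom_k(A, L)` is composition. -/
def pierceAct {A : DiffAlg k σk} (h : IdemSpanned L (L ⊗[k] A)) : DiffProfAct G σG where
  toDiffProf := (pierce (extension hσ)).obj (op A)
  act :=
    { smul := fun g x => toPierce ((ρ g : L →ₐ[k] L).comp (pointHom h x))
      one_smul := fun x => by
        change toPierce ((ρ 1 : L →ₐ[k] L).comp (pointHom h x)) = x
        rw [map_one]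
        exact toPierce_pointHom h x
      mul_smul := fun g g' x => by
        change toPierce ((ρ (g * g') : L →ₐ[k] L).comp (pointHom h x)) =
          toPierce ((ρ g : L →ₐ[k] L).comp
            (pointHom h (toPierce ((ρ g' : L →ₐ[k] L).comp (pointHom h x)))))
        rw [pointHom_toPierce, map_mul]
        rfl }
  contSMul := @ContinuousSMul.mk _ _ (_) _ _ (continuous_toPierce.comp (continuous_galComp.comp
    ((ρ.continuous.comp continuous_fst).prodMk
      ((continuous_pointHom h).comp continuous_snd))))
  σ_smul g x := by
    change PierceSpec.map (tensorσ (extension hσ) A) (toPierce ((ρ g : L →ₐ[k] L).comp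
      (pointHom h x))) = toPierce ((ρ (σG g) : L →ₐ[k] L).comp
        (pointHom h (PierceSpec.map (tensorσ (extension hσ) A) x)))
    rw [← toPierce_homσ hσ h, homσ_comp, galτ_apply hσ ρ hρ]
    exact congrArg (fun f => toPierce ((ρ (σG g) : L →ₐ[k] L).comp f)) (homσ_pointHom hσ h x)

theorem pointHom_smul {A : DiffAlg k σk} (h : IdemSpanned L (L ⊗[k] A)) (g : G)
    (x : (pierceAct hσ ρ hρ h).toDiffProf) :
    pointHom h (g • x) = (ρ g : L →ₐ[k] L).comp (pointHom h x) :=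
  pointHom_toPierce h _

/-- The functor `A ↦ S(L ⊗_k A)` to profinite spaces with action. -/
def pierceActFunctor : (SplitAlg (extension hσ))ᵒᵖ ⥤ DiffProfAct G σG where
  obj A := pierceAct hσ ρ hρ (A.unop.property.idemSpanned hσ)
  map {A B} φ :=
    { toHom := (pierce (extension hσ)).map φ.unop.hom.op
      smul := fun g x => by
        have hA := A.unop.property.idemSpanned hσ
        have hB := B.unop.property.idemSpanned hσ
        refine (homPierce hB).symm.injective ?_
        refine Eq.trans ?_ (pointHom_smul hσ ρ hρ hB g _).symm
        refine (pointHom_map hB hA (DiffAlg.Hom.toAlgHom φ.unop.hom) _).trans ?_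
        rw [pointHom_smul hσ ρ hρ hA]
        exact congrArg (ρ g : L →ₐ[k] L).comp
          (pointHom_map hB hA (DiffAlg.Hom.toAlgHom φ.unop.hom) x).symm }
  map_id A := DiffProfAct.Hom.ext ((pierce (extension hσ)).map_id (op A.unop.obj))
  map_comp φ ψ :=
    DiffProfAct.Hom.ext ((pierce (extension hσ)).map_comp φ.unop.hom.op ψ.unop.hom.op)

theorem isSplitElem_invariants (X : DiffProfAct G σG) :
    IsSplitElem k L (invariants (ρ : G →* (L ≃ₐ[k] L)) X) :=
  (isSplitElem_locallyConstant (k := k) (L := L) X.toDiffProf).of_injective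
    (invariants (ρ : G →* (L ≃ₐ[k] L)) X).val Subtype.val_injective

/-- The functor `X ↦ (f_! C_L(X))^G` takes values in split algebras. -/
def invariantsSplit : (DiffProfAct G σG)ᵒᵖ ⥤ SplitAlg (extension hσ) :=
  (IsSplit (extension hσ)).lift (invariantsFunctor hσ (ρ : G →* (L ≃ₐ[k] L)) hρ) fun X =>
    (isSplit_iff_isSplitBy hσ _).2
      (isSplitBy_iff_isSplitElem.2 (isSplitElem_invariants ρ X.unop))

/-! ### The unit -/

section Unit

variable {A : DiffAlg k σk} (h : IdemSpanned L (L ⊗[k] A))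

/-- The canonical map from `A` to the invariant functions on `S(L ⊗_k A)`. -/
def toInvariants :
    A →ₐ[k] invariants (ρ : G →* (L ≃ₐ[k] L)) (pierceAct hσ ρ hρ h) where
  toFun a := ⟨evalAlgHom h (1 ⊗ₜ a), (invariants_iff _ _ _).2 fun g x =>
    DFunLike.congr_fun (pointHom_smul hσ ρ hρ h g x) a⟩
  map_one' := Subtype.ext (LocallyConstant.ext fun x => map_one (pointHom h x))
  map_mul' a b := Subtype.ext (LocallyConstant.ext fun x => map_mul (pointHom h x) a b)
  map_zero' := Subtype.ext (LocallyConstant.ext fun x => map_zero (pointHom h x))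
  map_add' a b := Subtype.ext (LocallyConstant.ext fun x => map_add (pointHom h x) a b)
  commutes' c := Subtype.ext (LocallyConstant.ext fun x => (pointHom h x).commutes c)

theorem toInvariants_apply (a : A) (x : (pierceAct hσ ρ hρ h).toDiffProf) :
    (toInvariants hσ ρ hρ h a).1 x = pointHom h x a := rfl

/-- Under the Gelfand transform, the semilinear action of `G` on `Cont(S(L ⊗_k A), L)` is the action
on the factor `L` of `L ⊗_k A`. -/
theorem evalHom_map_gal (g : G) (z : L ⊗[k] A) (x : (pierceAct hσ ρ hρ h).toDiffProf) :
    evalHom h (g • x) (Algebra.TensorProduct.map (ρ g : L →ₐ[k] L) (AlgHom.id k A) z) =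
      ρ g (evalHom h x z) := by
  have hx : x = toPierce (pointHom h x) := (toPierce_pointHom h x).symm
  have hgx : g • x = toPierce ((ρ g : L →ₐ[k] L).comp (pointHom h x)) := rfl
  rw [hgx]
  conv_rhs => rw [hx]
  rw [evalHom_toPierce, evalHom_toPierce]
  induction z using TensorProduct.induction_on with
  | zero => simp
  | add x y hx hy => simp only [map_add, hx, hy]
  | tmul l a => simp

theorem toInvariants_bijective : Function.Bijective (toInvariants hσ ρ hρ h) := by
  constructor
  · intro a b hab
    exact Algebra.TensorProduct.includeRight_injective (algebraMap k L).injective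
      (evalAlgHom_injective h (congrArg Subtype.val hab))
  · rintro ⟨u, hu⟩
    obtain ⟨z, rfl⟩ := evalAlgHom_surjective h u
    have hu := (invariants_iff _ (pierceAct hσ ρ hρ h) _).1 hu
    obtain ⟨a, rfl⟩ := exists_eq_one_tmul z fun γ => evalAlgHom_injective h
      (LocallyConstant.ext fun x => by
        obtain ⟨g, rfl⟩ := ρ.surjective γ
        let y : (pierceAct hσ ρ hρ h).toDiffProf := x
        have h1 := evalHom_map_gal hσ ρ hρ h g z (g⁻¹ • y)
        have h2 : evalHom h (g • g⁻¹ • y) z = ρ g (evalHom h (g⁻¹ • y) z) := hu g (g⁻¹ • y)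
        rw [← h2, smul_inv_smul] at h1
        exact h1)
    exact ⟨a, rfl⟩

end Unit

/-! ### The counit -/

section Counit

variable (X : DiffProfAct G σG)

/-- Evaluation of invariant functions at a point. -/
def evalInvariants (x : X.toDiffProf) : invariants (ρ : G →* (L ≃ₐ[k] L)) X →ₐ[k] L :=
  (LocallyConstant.evalₐ k x).comp (invariants (ρ : G →* (L ≃ₐ[k] L)) X).val

/-- The canonical morphism from `X` to `S(L ⊗_k (f_! C_L(X))^G)`. -/
def toPierceAct :
    X ⟶ (pierceActFunctor hσ ρ hρ).obj (op ((invariantsSplit hσ ρ hρ).obj (op X))) where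
  toHom :=
    { toMap := ⟨fun x => toPierce (evalInvariants ρ X x), continuous_toPierce.comp
        (continuous_generateFrom_iff.2 (by
          rintro _ ⟨u, b, rfl⟩
          exact u.1.2.isOpen_fiber b))⟩
      comm := fun x => by
        have hI := (isSplitElem_invariants ρ X).idemSpanned
        refine Eq.trans (congrArg toPierce ?_) (toPierce_homσ hσ
          (A := (invariantsFunctor hσ (ρ : G →* (L ≃ₐ[k] L)) hρ).obj (op X)) hI
            (evalInvariants ρ X x))
        exact (homσ_unique hσ
          (A := (invariantsFunctor hσ (ρ : G →* (L ≃ₐ[k] L)) hρ).obj (op X)) hI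
            fun u => rfl).symm }
  smul g x := by
    have hI := (isSplitElem_invariants ρ X).idemSpanned
    refine congrArg toPierce ?_
    refine Eq.trans ?_ (congrArg (ρ g : L →ₐ[k] L).comp
      (pointHom_toPierce hI (evalInvariants ρ X x))).symm
    exact AlgHom.ext fun u => (invariants_iff _ _ _).1 u.2 g x

/-- `exists_equivariant_ne` for the action of `G ≃ Gal(L/k)`. -/
theorem exists_invariant_ne {U : Set X.toDiffProf} (hU : IsClopen U) {x : X.toDiffProf}
    (hx : x ∈ U) :
    (∀ y ∉ U, ∃ u ∈ invariants (ρ : G →* (L ≃ₐ[k] L)) X, u x ≠ u y) ∧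
    ∃ u ∈ invariants (ρ : G →* (L ≃ₐ[k] L)) X, u x ≠ 0 ∧
      ∀ y, (∀ g : G, g • y ∉ U) → u y = 0 := by
  let : MulAction (L ≃ₐ[k] L) X.toDiffProf :=
    MulAction.compHom X.toDiffProf (ρ.symm : (L ≃ₐ[k] L) →* G)
  have : ContinuousSMul (L ≃ₐ[k] L) X.toDiffProf :=
    MulAction.continuousSMul_compHom (f := (ρ.symm : (L ≃ₐ[k] L) →* G)) ρ.symm.continuous
  have hmem : ∀ u : LocallyConstant X.toDiffProf L,
      (∀ (γ : L ≃ₐ[k] L) z, u (γ • z) = γ (u z)) →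
        u ∈ invariants (ρ : G →* (L ≃ₐ[k] L)) X := fun u hu =>
    (invariants_iff _ _ _).2 fun g z => by
      have := hu (ρ g) z
      change u (ρ.symm (ρ g) • z) = _ at this
      rwa [ρ.symm_apply_apply] at this
  obtain ⟨h1, u, hu, hux, hu0⟩ := exists_equivariant_ne (k := k) (L := L) hU hx
  refine ⟨fun y hy => ?_, u, hmem u hu, hux, fun y hy => hu0 y fun γ => hy (ρ.symm γ)⟩
  obtain ⟨u, hu, hne⟩ := h1 y hy
  exact ⟨u, hmem u hu, hne⟩

theorem toPierceAct_bijective :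
    Function.Bijective (DiffProfAct.Hom.toHom (toPierceAct hσ ρ hρ X)).toMap := by
  let A := (invariantsFunctor hσ (ρ : G →* (L ≃ₐ[k] L)) hρ).obj (op X)
  have hI : IdemSpanned L (L ⊗[k] A) := (isSplitElem_invariants ρ X).idemSpanned
  let Y := pierceAct hσ ρ hρ hI
  let c : X ⟶ Y := toPierceAct hσ ρ hρ X
  have hc : ∀ x, pointHom hI ((DiffProfAct.Hom.toHom c).toMap x) = evalInvariants ρ X x :=
    fun x => pointHom_toPierce hI _
  constructor
  · intro x y hxy
    by_contra hne
    obtain ⟨U, hU, hxU, hyU⟩ := exists_isClopen_of_totally_separated hne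
    obtain ⟨u, hu, huxy⟩ := (exists_invariant_ne ρ X hU hxU).1 y hyU
    refine huxy ?_
    have := DFunLike.congr_fun ((hc x).symm.trans ((congrArg (pointHom hI) hxy).trans (hc y)))
      ⟨u, hu⟩
    exact this
  · -- A point outside the (closed, stable) image would be detected by an invariant function on
    -- `S(L ⊗_k A)`, hence by an element of `A`, vanishing on the image, hence zero in `A`.
    by_contra hsurj
    obtain ⟨y, hy⟩ := not_forall.1 hsurj
    have hclosed : IsClosed (Set.range (DiffProfAct.Hom.toHom c).toMap) :=
      (isCompact_range (DiffProfAct.Hom.toHom c).toMap.continuous).isClosed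
    obtain ⟨U, hU, hyU, hUc⟩ := compact_exists_isClopen_in_isOpen hclosed.isOpen_compl
      (show y ∈ (Set.range (DiffProfAct.Hom.toHom c).toMap)ᶜ from hy)
    obtain ⟨u, hu, huy, hu0⟩ := (exists_invariant_ne ρ Y hU hyU).2
    obtain ⟨a, ha⟩ := (toInvariants_bijective hσ ρ hρ hI).2 ⟨u, hu⟩
    have hu' : ∀ z : Y.toDiffProf, u z = pointHom hI z a := fun z => by
      rw [← toInvariants_apply hσ ρ hρ hI, ha]
    have ha0 : a = 0 := Subtype.ext (LocallyConstant.ext fun x => by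
      have h1 := hu0 ((DiffProfAct.Hom.toHom c).toMap x) fun g hg => hUc hg
        ⟨g • x, DiffProfAct.Hom.smul c g x⟩
      rw [hu', hc] at h1
      exact h1)
    exact huy ((hu' y).trans (by rw [ha0, map_zero]))

end Counit

/-! ### The equivalence -/

/-- The unit `A ≅ Cont(S(L ⊗_k A), L)^G` of the equivalence. -/
def unitIso : 𝟭 (SplitAlg (extension hσ))ᵒᵖ ≅
    pierceActFunctor hσ ρ hρ ⋙ (invariantsSplit hσ ρ hρ).rightOp :=
  let η : ∀ A : SplitAlg (extension hσ), A ≅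
      (invariantsSplit hσ ρ hρ).obj (op ((pierceActFunctor hσ ρ hρ).obj (op A))) := fun A =>
    (IsSplit (extension hσ)).isoMk (DiffAlg.isoMk
      (B := (invariantsFunctor hσ (ρ : G →* (L ≃ₐ[k] L)) hρ).obj
        (op ((pierceActFunctor hσ ρ hρ).obj (op A))))
      (AlgEquiv.ofBijective _ (toInvariants_bijective hσ ρ hρ (A.property.idemSpanned hσ)))
      fun a => Subtype.ext (LocallyConstant.ext fun x => by
        have h := A.property.idemSpanned hσ
        exact (apply_σ hσ h (pointHom h x) a).trans
          (congrArg (fun f => σL (f a)) (homσ_pointHom hσ h x))))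
  NatIso.ofComponents (fun A => (η A.unop).symm.op) fun {A B} f => by
    refine Quiver.Hom.unop_inj ?_
    change (η B.unop).inv ≫ f.unop = (invariantsSplit hσ ρ hρ).map
      ((pierceActFunctor hσ ρ hρ).map f).op ≫ (η A.unop).inv
    rw [Iso.inv_comp_eq, ← Category.assoc, Iso.eq_comp_inv]
    refine ObjectProperty.hom_ext _ (DiffAlg.Hom.ext (AlgHom.ext fun b =>
      Subtype.ext (LocallyConstant.ext fun x => ?_)))
    exact (DFunLike.congr_fun (pointHom_map (B.unop.property.idemSpanned hσ)
      (A.unop.property.idemSpanned hσ) (DiffAlg.Hom.toAlgHom f.unop.hom) x) b).symm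

/-- The counit of the equivalence, inverse to `X ≅ S(L ⊗_k Cont(X, L)^G)`. -/
def counitIso : (invariantsSplit hσ ρ hρ).rightOp ⋙ pierceActFunctor hσ ρ hρ ≅
    𝟭 (DiffProfAct G σG) :=
  (NatIso.ofComponents (fun X => DiffProfAct.isoOfBijective (toPierceAct hσ ρ hρ X)
    (toPierceAct_bijective hσ ρ hρ X)) fun {X Y} f => by
      refine DiffProfAct.Hom.ext (DiffProf.Hom.ext (ContinuousMap.ext fun x => ?_))
      exact (map_toPierce (DiffAlg.Hom.toAlgHom ((invariantsFunctor hσ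
        (ρ : G →* (L ≃ₐ[k] L)) hρ).map f.op)) (evalInvariants ρ X x)).symm).symm

/-- The equivalence between split algebras and profinite spaces with action. -/
def splitEquivalence : (SplitAlg (extension hσ))ᵒᵖ ≌ DiffProfAct G σG :=
  CategoryTheory.Equivalence.mk (pierceActFunctor hσ ρ hρ) (invariantsSplit hσ ρ hρ).rightOp
    (unitIso hσ ρ hρ) (counitIso hσ ρ hρ)

end Functors

end DiffGalois

end

theorem theorem3p30 {k L : Type u} [Field k] [Field L] [Algebra k L] [IsGalois k L]
    (σk : k →+* k) (σL : L →+* L)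
    (hσ : ∀ c : k, σL (algebraMap k L c) = algebraMap k L (σk c)) :
    -- the objects of `Split_k(f)`
    (∀ A : DiffAlg k σk,
      (IsSplit (extension hσ) A ↔ IsSplitBy k L A) ∧ (IsSplitBy k L A ↔ IsSplitElem k L A)) ∧
    -- the difference profinite group `(Gal(L/k), ()^σ)`
    ∃ τ : (L ≃ₐ[k] L) →* (L ≃ₐ[k] L), Continuous τ ∧
      (∀ (g : L ≃ₐ[k] L) (x : L), g (σL x) = σL (τ g x)) ∧
    -- the difference profinite group `Gal[f] = S(L ⊗_k L)`
    ∃ _ : Group (GalSpace (extension hσ)), IsCategoricalGaloisGroup (extension hσ) ∧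
    -- the isomorphisms `Aut⟦L⟧_k ≃ Gal(L/k) ≃ Gal[f]` of difference profinite groups
    ∃ (ε : IntAut (extension hσ) ≃ₜ* (L ≃ₐ[k] L))
      (ρ : GalSpace (extension hσ) ≃ₜ* (L ≃ₐ[k] L))
      (hρ : ∀ (g : GalSpace (extension hσ)) (x : L),
        (ρ : GalSpace (extension hσ) →* (L ≃ₐ[k] L)) g (σL x) =
          σL ((ρ : GalSpace (extension hσ) →* (L ≃ₐ[k] L)) (galσ (extension hσ) g) x)),
      (∀ f : IntAut (extension hσ), ε f = f.comp 0) ∧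
      (∀ f : IntAut (extension hσ), ε f.shift = τ (ε f)) ∧
      (∀ g : L ≃ₐ[k] L, ρ.symm g = toPierce (g : L →ₐ[k] L)) ∧
      (∀ x : GalSpace (extension hσ), ρ (galσ (extension hσ) x) = τ (ρ x)) ∧
    -- the equivalence `E : Split_k(f) ≃ [Gal[f], P]` with underlying functor `A ↦ S(L ⊗_k A)`
    ∃ (E : (SplitAlg (extension hσ))ᵒᵖ ≌
        DiffProfAct (GalSpace (extension hσ)) (galσ (extension hσ)))
      (α : E.functor ⋙ DiffProfAct.forget (GalSpace (extension hσ)) (galσ (extension hσ)) ≅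
        (IsSplit (extension hσ)).ι.op ⋙ pierce (extension hσ)),
      (∀ A : SplitAlg (extension hσ),
        -- the action of `Gal[f]` on `S(L ⊗_k A)` is the action of the groupoid
        IsHomeomorph (fun w : PierceSpec (L ⊗[k] (L ⊗[k] A.obj)) =>
          (pr₁₂ (extension hσ) A.obj w, pr₂₃ (extension hσ) A.obj w)) ∧
        (∀ (w : PierceSpec (L ⊗[k] (L ⊗[k] A.obj))) (x : (E.functor.obj (op A)).toDiffProf),
          (α.hom.app (op A)).toMap x = pr₂₃ (extension hσ) A.obj w →
            (α.hom.app (op A)).toMap (pr₁₂ (extension hσ) A.obj w • x) =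
              pr₁₃ (extension hσ) A.obj w) ∧
        -- the difference profinite space `(Hom_k(A, L), ()^σ)`
        ∃ t : (A.obj →ₐ[k] L) → (A.obj →ₐ[k] L), Continuous t ∧
          (∀ (f : A.obj →ₐ[k] L) (a : A.obj), f (A.obj.σ a) = σL (t f a)) ∧
          -- `⟦A, L⟧_k ≃ (Hom_k(A, L), ()^σ)`, compatibly with the actions by composition
          IsHomeomorph (fun f : IntHom A.obj (extension hσ) => f.comp 0) ∧
          (∀ f : IntHom A.obj (extension hσ), f.shift.comp 0 = t (f.comp 0)) ∧
          (∀ (g : IntAut (extension hσ)) (f : IntHom A.obj (extension hσ)),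
            (g.toIntHom.mul f).comp 0 = (ε g : L →ₐ[k] L).comp (f.comp 0)) ∧
          -- `(Hom_k(A, L), ()^σ) ≃ S(L ⊗_k A)`, compatibly with the actions
          IsHomeomorph (fun f : A.obj →ₐ[k] L => toPierce f) ∧
          (∀ f : A.obj →ₐ[k] L,
            toPierce (t f) = PierceSpec.map (tensorσ (extension hσ) A.obj) (toPierce f)) ∧
          (∀ (g : L ≃ₐ[k] L) (f : A.obj →ₐ[k] L) (x : (E.functor.obj (op A)).toDiffProf),
            (α.hom.app (op A)).toMap x = toPierce f →
              (α.hom.app (op A)).toMap (ρ.symm g • x) = toPierce ((g : L →ₐ[k] L).comp f))) ∧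
      -- the identifications are natural in `A`
      (∀ (A B : SplitAlg (extension hσ)) (φ : A ⟶ B) (f : B.obj →ₐ[k] L),
        toPierce (f.comp φ.hom.toAlgHom) =
          ((pierce (extension hσ)).map φ.hom.op).toMap (toPierce f)) ∧
      -- the quasi-inverse
      Nonempty (E.inverse.leftOp ⋙ (IsSplit (extension hσ)).ι ≅
        invariantsFunctor hσ (ρ : GalSpace (extension hσ) →* (L ≃ₐ[k] L)) hρ) := by
  refine ⟨fun A => ⟨isSplit_iff_isSplitBy hσ A, isSplitBy_iff_isSplitElem⟩, galτ hσ,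
    continuous_galτ hσ, galτ_spec hσ, galSpaceGroup hσ, isCategoricalGaloisGroup hσ,
    intAutEquiv hσ, galSpaceEquiv hσ,
    galSpaceHomeo_apply_σ hσ, fun f => rfl, intAutEquiv_shift hσ, fun g => rfl,
    galSpaceHomeo_galσ hσ, ?_⟩
  let := galSpaceGroup hσ
  refine ⟨splitEquivalence hσ (galSpaceEquiv hσ) (galSpaceHomeo_apply_σ hσ), Iso.refl _,
    fun A => ?_,
    fun A B φ f => (map_toPierce _ f).symm, ⟨Iso.refl _⟩⟩
  have h := A.property.idemSpanned hσ
  have hact : ∀ (g : L ≃ₐ[k] L) (f : A.obj →ₐ[k] L), toPierce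
      ((galSpaceHomeo hσ ((galSpaceHomeo hσ).symm g) : L →ₐ[k] L).comp
        (pointHom h (toPierce f))) = toPierce ((g : L →ₐ[k] L).comp f) := fun g f => by
    rw [Homeomorph.apply_symm_apply, pointHom_toPierce]
  refine ⟨isHomeomorph_pr₁₂_pr₂₃ hσ h, fun w x hx => ?_, homσ hσ h, continuous_homσ hσ h,
    apply_σ hσ h, (intHomHomeo hσ h).isHomeomorph, shift_comp_zero hσ h, fun g f => rfl,
    (homPierce h).isHomeomorph, toPierce_homσ hσ h, fun g f x hx => ?_⟩
  · obtain ⟨g, f, rfl⟩ := exists_eq_compPoint h w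
    obtain rfl : x = (toPierce f : PierceSpec (L ⊗[k] A.obj)) :=
      Eq.trans hx (pr₂₃_compPoint hσ g f)
    rw [pr₁₂_compPoint, pr₁₃_compPoint]
    exact hact g f
  · obtain rfl : x = (toPierce f : PierceSpec (L ⊗[k] A.obj)) := hx
    exact hact g f
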